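/- Let $k$ be a commutative unital ring and $D$ a unital associative $k$-algebra. Let $V=M(1,3,D)=(\mathrm{Mat}(1,3,D),\mathrm{Mat}(3,1,D))$ be the rectangular matrix Jordan pair, with triple product $\{xyz\}=xyz+zyx$, and let $L=\mathrm{TKK}(V)=V^+\oplus\mathfrak{instr}(V)\oplus V^-$ be its Tits--Kantor--Koecher algebra, where $\mathfrak{instr}(V)$ is spanned by the operators $\delta(x,y)=[x,y]$, $\delta(x,y)=(\{x\,y\,\cdot\},-\{y\,x\,\cdot\})$, $x\in V^+$, $y\in V^-$. Let $R=\{\varepsilon_i-\varepsilon_j: 1\le i,j\le 4\}$ be the root system of type $A_3$ (including $0$), and number the row index of $V^+$ by $1$ and its column indices by $2,3,4$. Then $L$ is graded by the root lattice $\mathcal Q(R)$: for $i\ne j$ the component of degree $\varepsilon_i-\varepsilon_j$ is $\{E_{ij}(a):a\in D\}$, where $E_{1j}(a)\in V^+$ and $E_{j1}(a)\in V^-$ are matrix units times $a$, and $E_{ji}(a)=-\delta(E_{1i}(a),E_{j1}(1))$ for distinct $i,j\in\{2,3,4\}$; the component of degree $0$ is $\sum_j\delta(E_{1j}(D),E_{j1}(D))$.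 Let $\mathfrak{uce}(L)=(L\wedge L)/\mathcal B$, where $\mathcal B$ is the submodule generated by all $x\wedge[y,z]+y\wedge[z,x]+z\wedge[x,y]$, and write $\langle x,y\rangle$ for the class of $x\wedge y$. It is a Lie algebra with bracket $[X,Y]=\langle u(X),u(Y)\rangle$, where $u:\mathfrak{uce}(L)\to L$, $u(\langle x,y\rangle)=[x,y]$, and it is graded by $\mathfrak{uce}(L)_\gamma=\sum_\delta\langle L_\delta,L_{\gamma-\delta}\rangle$. A degenerate sum is a sum $\gamma=\alpha+\beta$ of two linearly independent roots for which the greatest integer $n$ with $\langle\gamma,R^\vee\rangle\subseteq n\mathbb Z$ satisfies $n>1$. Let $D_2=D/(2D,[D,D])$ be the quotient of $D$ by the two-sided ideal generated by $2D$ and $[D,D]$, and let $\bar a$ be the class of $a\in D$ in $D_2$. Then: (0) For every root $\alpha=\varepsilon_i-\varepsilon_j\neq 0$ and every $a\in D$ there is a unique $x_\alpha(a)\in\mathfrak{uce}(L)_\alpha$ with $u(x_\alpha(a))=E_{ij}(a)$. (i) There are exactly six degenerate sums, namely $\pm(\varepsilon_1-\varepsilon_2+\varepsilon_3-\varepsilon_4)$,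 $\pm(\varepsilon_1-\varepsilon_2-\varepsilon_3+\varepsilon_4)$, $\pm(\varepsilon_1+\varepsilon_2-\varepsilon_3-\varepsilon_4)$, and every $\gamma\notin R$ with $\mathfrak{uce}(L)_\gamma\ne 0$ is one of them. (ii) For every degenerate sum $\gamma$ there is a $k$-module isomorphism $\mathfrak{uce}(L)_\gamma\cong D_2$ which maps $[x_\alpha(a),x_\beta(b)]$ to $\overline{ab}$ for all nonzero roots $\alpha,\beta$ with $\alpha+\beta=\gamma$ and all $a,b\in D$. -/

import Mathlib

open scoped TensorProduct

/-! ### The Tits-Kantor-Koecher algebra of the rectangular matrix Jordan pair -/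

section MatrixPair

variable (k : Type*) [CommRing k] {I J D : Type*} [Fintype I] [Fintype J]
  [Ring D] [Algebra k D]

/-- The Jordan triple product `{x, y, z} = x y z + z y x` of the rectangular matrix Jordan pair
`M(I, J, D) = (Mat(I, J, D), Mat(J, I, D))`, as the endomorphism `D_{x,y} : z ↦ {x, y, z}`.
Exchanging `I` and `J` gives the triple product on the negative part. -/
def jordanTriple (x : Matrix I J D) (y : Matrix J I D) : Module.End k (Matrix I J D) where
  toFun z := x * y * z + z * y * x
  map_add' z w := by simp only [Matrix.mul_add, Matrix.add_mul]; abel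
  map_smul' c z := by simp [Matrix.mul_smul, Matrix.smul_mul, smul_add]

@[simp] theorem jordanTriple_apply (x : Matrix I J D) (y : Matrix J I D) (z : Matrix I J D) :
    jordanTriple k x y z = x * y * z + z * y * x := rfl

/-- The triple product is the linearization of the quadratic operator `Q_x y = x y x`. -/
theorem jordanTriple_eq_linearization (x z : Matrix I J D) (y : Matrix J I D) :
    jordanTriple k x y z = (x + z) * y * (x + z) - x * y * x - z * y * z := by
  simp only [jordanTriple_apply, Matrix.mul_add, Matrix.add_mul]; abel

/-- The inner derivation `δ(x, y) = (D_{x,y}, -D_{y,x})`, acting on both parts of the pair. -/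
def innerDelta (x : Matrix I J D) (y : Matrix J I D) :
    Module.End k (Matrix I J D) × Module.End k (Matrix J I D) :=
  (jordanTriple k x y, -jordanTriple k y x)

theorem innerDelta_add_left (x x' : Matrix I J D) (y : Matrix J I D) :
    innerDelta k (x + x') y = innerDelta k x y + innerDelta k x' y := by
  refine Prod.ext (LinearMap.ext fun z => ?_) (LinearMap.ext fun z => ?_) <;>
    simp [innerDelta, Matrix.mul_add, Matrix.add_mul] <;> abel

theorem innerDelta_add_right (x : Matrix I J D) (y y' : Matrix J I D) :
    innerDelta k x (y + y') = innerDelta k x y + innerDelta k x y' := by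
  refine Prod.ext (LinearMap.ext fun z => ?_) (LinearMap.ext fun z => ?_) <;>
    simp [innerDelta, Matrix.mul_add, Matrix.add_mul] <;> abel

theorem innerDelta_smul_left (c : k) (x : Matrix I J D) (y : Matrix J I D) :
    innerDelta k (c • x) y = c • innerDelta k x y := by
  refine Prod.ext (LinearMap.ext fun z => ?_) (LinearMap.ext fun z => ?_) <;>
    simp [innerDelta, smul_add]

theorem innerDelta_smul_right (c : k) (x : Matrix I J D) (y : Matrix J I D) :
    innerDelta k x (c • y) = c • innerDelta k x y := by
  refine Prod.ext (LinearMap.ext fun z => ?_) (LinearMap.ext fun z => ?_) <;>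
    simp [innerDelta, smul_add]

variable (I J D) in
/-- The inner derivation algebra `instr(V)` of `V = M(I, J, D)`: the span of all `δ(x, y)`. -/
def innerDer : Submodule k (Module.End k (Matrix I J D) × Module.End k (Matrix J I D)) :=
  Submodule.span k {T | ∃ x y, T = innerDelta k x y}

theorem innerDelta_mem (x : Matrix I J D) (y : Matrix J I D) :
    innerDelta k x y ∈ innerDer k I J D :=
  Submodule.subset_span ⟨x, y, rfl⟩

/-- `[T, δ(x, y)] = δ(T x, y) + δ(x, T y)` for every inner derivation `T`. -/
theorem innerDer_commutator {T : Module.End k (Matrix I J D) × Module.End k (Matrix J I D)}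
    (hT : T ∈ innerDer k I J D) (x : Matrix I J D) (y : Matrix J I D) :
    T * innerDelta k x y - innerDelta k x y * T =
      innerDelta k (T.1 x) y + innerDelta k x (T.2 y) := by
  induction hT using Submodule.span_induction with
  | mem T h =>
    obtain ⟨z, w, rfl⟩ := h
    refine Prod.ext (LinearMap.ext fun v => ?_) (LinearMap.ext fun v => ?_) <;>
      simp [innerDelta, Matrix.mul_add, Matrix.add_mul, Matrix.mul_assoc] <;> abel
  | zero =>
    refine Prod.ext (LinearMap.ext fun v => ?_) (LinearMap.ext fun v => ?_) <;>
      simp [innerDelta]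
  | add S T _ _ hS hT =>
    have e : (S + T) * innerDelta k x y - innerDelta k x y * (S + T) =
        (S * innerDelta k x y - innerDelta k x y * S) +
          (T * innerDelta k x y - innerDelta k x y * T) := by
      rw [add_mul, mul_add]; abel
    rw [e, hS, hT]
    simp only [Prod.fst_add, Prod.snd_add, LinearMap.add_apply, innerDelta_add_left,
      innerDelta_add_right]
    abel
  | smul c T _ hT =>
    have e : (c • T) * innerDelta k x y - innerDelta k x y * (c • T) =
        c • (T * innerDelta k x y - innerDelta k x y * T) := by
      rw [smul_mul_assoc, mul_smul_comm, smul_sub]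
    rw [e, hT]
    simp only [Prod.smul_fst, Prod.smul_snd, LinearMap.smul_apply, innerDelta_smul_left,
      innerDelta_smul_right, smul_add]

theorem innerDer_commutator_mem
    {S T : Module.End k (Matrix I J D) × Module.End k (Matrix J I D)}
    (hS : S ∈ innerDer k I J D) (hT : T ∈ innerDer k I J D) :
    S * T - T * S ∈ innerDer k I J D := by
  induction hT using Submodule.span_induction with
  | mem T h =>
    obtain ⟨x, y, rfl⟩ := h
    rw [innerDer_commutator k hS]
    exact add_mem (innerDelta_mem k _ _) (innerDelta_mem k _ _)
  | zero => simp
  | add T U _ _ hT hU =>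
    have e : S * (T + U) - (T + U) * S = (S * T - T * S) + (S * U - U * S) := by
      rw [add_mul, mul_add]; abel
    rw [e]; exact add_mem hT hU
  | smul c T _ hT =>
    have e : S * (c • T) - (c • T) * S = c • (S * T - T * S) := by
      rw [smul_mul_assoc, mul_smul_comm, smul_sub]
    rw [e]; exact Submodule.smul_mem _ c hT

variable (I J D) in
/-- The module `TKK(V) = V⁺ ⊕ instr(V) ⊕ V⁻` for `V = M(I, J, D)`. -/
@[ext]
structure TKK where
  /-- the component in `V⁺ = Mat(I, J, D)` -/
  pos : Matrix I J D
  /-- the component in `instr(V)` -/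
  inn : innerDer k I J D
  /-- the component in `V⁻ = Mat(J, I, D)` -/
  neg : Matrix J I D

namespace TKK

variable (I J D) in
/-- `TKK(V)` as a product. -/
def equivProd : TKK k I J D ≃ Matrix I J D × innerDer k I J D × Matrix J I D where
  toFun X := (X.pos, X.inn, X.neg)
  invFun X := ⟨X.1, X.2.1, X.2.2⟩
  left_inv _ := rfl
  right_inv _ := rfl

instance : AddCommGroup (TKK k I J D) := (equivProd k I J D).addCommGroup

instance : Module k (TKK k I J D) := (equivProd k I J D).module k

@[simp] theorem pos_add (X Y : TKK k I J D) : (X + Y).pos = X.pos + Y.pos := rfl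
@[simp] theorem inn_add (X Y : TKK k I J D) : (X + Y).inn = X.inn + Y.inn := rfl
@[simp] theorem neg_add (X Y : TKK k I J D) : (X + Y).neg = X.neg + Y.neg := rfl
@[simp] theorem pos_zero : (0 : TKK k I J D).pos = 0 := rfl
@[simp] theorem inn_zero : (0 : TKK k I J D).inn = 0 := rfl
@[simp] theorem neg_zero : (0 : TKK k I J D).neg = 0 := rfl
@[simp] theorem pos_smul (c : k) (X : TKK k I J D) : (c • X).pos = c • X.pos := rfl
@[simp] theorem inn_smul (c : k) (X : TKK k I J D) : (c • X).inn = c • X.inn := rfl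
@[simp] theorem neg_smul (c : k) (X : TKK k I J D) : (c • X).neg = c • X.neg := rfl

/-- The bracket of `TKK(V)`: for `x, x' ∈ V⁺`, `y, y' ∈ V⁻` and `T, T' ∈ instr(V)`,
`[x, y] = δ(x, y)`, `[T, x] = T x`, `[T, y] = T y`, `[T, T'] = T T' - T' T`, and
`[x, x'] = [y, y'] = 0`. -/
instance : Bracket (TKK k I J D) (TKK k I J D) where
  bracket X Y :=
    { pos := X.inn.1.1 Y.pos - Y.inn.1.1 X.pos
      inn := ⟨X.inn.1 * Y.inn.1 - Y.inn.1 * X.inn.1, innerDer_commutator_mem k X.inn.2 Y.inn.2⟩ +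
        ⟨innerDelta k X.pos Y.neg, innerDelta_mem k _ _⟩ -
        ⟨innerDelta k Y.pos X.neg, innerDelta_mem k _ _⟩
      neg := X.inn.1.2 Y.neg - Y.inn.1.2 X.neg }

@[simp] theorem pos_lie (X Y : TKK k I J D) :
    ⁅X, Y⁆.pos = X.inn.1.1 Y.pos - Y.inn.1.1 X.pos := rfl
@[simp] theorem neg_lie (X Y : TKK k I J D) :
    ⁅X, Y⁆.neg = X.inn.1.2 Y.neg - Y.inn.1.2 X.neg := rfl
@[simp] theorem coe_inn_lie (X Y : TKK k I J D) :
    (⁅X, Y⁆.inn : Module.End k (Matrix I J D) × Module.End k (Matrix J I D)) =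
      X.inn.1 * Y.inn.1 - Y.inn.1 * X.inn.1 + innerDelta k X.pos Y.neg
        - innerDelta k Y.pos X.neg := rfl

theorem innerDelta_sub_left (x x' : Matrix I J D) (y : Matrix J I D) :
    innerDelta k (x - x') y = innerDelta k x y - innerDelta k x' y := by
  rw [eq_sub_iff_add_eq, ← innerDelta_add_left, sub_add_cancel]

theorem innerDelta_sub_right (x : Matrix I J D) (y y' : Matrix J I D) :
    innerDelta k x (y - y') = innerDelta k x y - innerDelta k x y' := by
  rw [eq_sub_iff_add_eq, ← innerDelta_add_right, sub_add_cancel]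

instance : LieRing (TKK k I J D) where
  add_lie X Y Z := by
    refine TKK.ext ?_ (Subtype.ext ?_) ?_
    · simp; abel
    · simp [innerDelta_add_left, innerDelta_add_right, add_mul, mul_add]; abel
    · simp; abel
  lie_add X Y Z := by
    refine TKK.ext ?_ (Subtype.ext ?_) ?_
    · simp; abel
    · simp [innerDelta_add_left, innerDelta_add_right, add_mul, mul_add]; abel
    · simp; abel
  lie_self X := by
    refine TKK.ext ?_ (Subtype.ext ?_) ?_ <;> simp
  leibniz_lie X Y Z := by
    refine TKK.ext ?_ (Subtype.ext ?_) ?_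
    · simp [innerDelta, Matrix.mul_assoc]; abel
    · have h1 := innerDer_commutator k X.inn.2 Y.pos Z.neg
      have h2 := innerDer_commutator k X.inn.2 Z.pos Y.neg
      have h3 := innerDer_commutator k Y.inn.2 X.pos Z.neg
      have h4 := innerDer_commutator k Y.inn.2 Z.pos X.neg
      have h5 := innerDer_commutator k Z.inn.2 X.pos Y.neg
      have h6 := innerDer_commutator k Z.inn.2 Y.pos X.neg
      simp only [inn_add, Submodule.coe_add, coe_inn_lie, pos_lie, neg_lie,
        innerDelta_sub_left, innerDelta_sub_right]
      rw [← sub_eq_zero] at h1 h2 h3 h4 h5 h6 ⊢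
      rw [← neg_eq_zero] at h2 h3 h6
      refine Eq.trans ?_ (show _ = _ from (congrArg₂ (· + ·) (congrArg₂ (· + ·)
        (congrArg₂ (· + ·) h1 h2) (congrArg₂ (· + ·) h3 h4))
        (congrArg₂ (· + ·) h5 h6)).trans (by simp))
      simp only [mul_add, add_mul, mul_sub, sub_mul, mul_assoc]
      abel
    · simp [innerDelta, Matrix.mul_assoc]; abel

instance : LieAlgebra k (TKK k I J D) where
  lie_smul c X Y := by
    refine TKK.ext ?_ (Subtype.ext ?_) ?_
    · simp [smul_sub]
    · simp [innerDelta_smul_left, innerDelta_smul_right, smul_sub, smul_add]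
    · simp [smul_sub]

end TKK

end MatrixPair

/-! ### The root system of type A and degenerate sums -/

section RootSystem

variable {K : Type*} [Fintype K] [DecidableEq K]

/-- The standard basis vector `ε_p` of `ℤ^K`. -/
def eps (p : K) : K → ℤ := Pi.single p 1

variable (K) in
/-- The nonzero roots `ε_p - ε_q`, `p ≠ q`, of the root system of type A on the index set `K`
(of type `A_{n-1}` if `K` has `n` elements). The root lattice is the subgroup of `ℤ^K` that they
span, and gradings by it are regarded as gradings by `ℤ^K`. -/
def nonzeroRoots : Set (K → ℤ) := {α | ∃ p q, p ≠ q ∧ α = eps p - eps q}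

variable (K) in
/-- The root system of type A, which contains `0`. -/
def rootSystemA : Set (K → ℤ) := insert 0 (nonzeroRoots K)

/-- The number `⟨γ, α^∨⟩ = 2 (γ | α) / (α | α) = (γ | α)`, for `α` a root, as `(α | α) = 2`. -/
def corootPairing (γ α : K → ℤ) : ℤ := γ ⬝ᵥ α

/-- `n` is the divisor of `γ`: the greatest natural number with `⟨γ, R^∨⟩ ⊆ n ℤ`. -/
def IsDivisorOf (n : ℕ) (γ : K → ℤ) : Prop :=
  IsGreatest {m : ℕ | ∀ α ∈ nonzeroRoots K, (m : ℤ) ∣ corootPairing γ α} n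

/-- A degenerate sum: a sum of two linearly independent roots with divisor greater than `1`. -/
def IsDegenerateSum (γ : K → ℤ) : Prop :=
  (∃ α ∈ nonzeroRoots K, ∃ β ∈ nonzeroRoots K, LinearIndependent ℤ ![α, β] ∧ γ = α + β) ∧
    ∃ n : ℕ, 1 < n ∧ IsDivisorOf n γ

end RootSystem

/-! ### The root grading of the TKK algebra and its root vectors -/

section Grading

variable (k : Type*) [CommRing k] {I J D : Type*} [Fintype I] [Fintype J]
  [DecidableEq I] [DecidableEq J] [Ring D] [Algebra k D]

/-- The inclusion of `V⁺` in `TKK(V)`. -/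
def TKK.ofPos (x : Matrix I J D) : TKK k I J D := ⟨x, 0, 0⟩

/-- The inclusion of `V⁻` in `TKK(V)`. -/
def TKK.ofNeg (y : Matrix J I D) : TKK k I J D := ⟨0, 0, y⟩

/-- The element `δ(x, y)` of `TKK(V)`. -/
def TKK.ofDelta (x : Matrix I J D) (y : Matrix J I D) : TKK k I J D :=
  ⟨0, ⟨innerDelta k x y, innerDelta_mem k x y⟩, 0⟩

variable (I J D) in
/-- The homogeneous component of degree `γ` of `L = TKK(M(I, J, D))`, for the grading by the
root lattice of type A on `I ∪ J`: the elements `E_{ij} a` of `V⁺` have degree `ε_i - ε_j`, the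
elements `E_{ji} a` of `V⁻` have degree `ε_j - ε_i`, and in `instr(V)` the component of degree `γ`
is the sum of all `[L_α, L_β]` with `α` the degree of some `E_{ij} a`, `β` the degree of some
`E_{lm} b` (`i, m ∈ I`, `j, l ∈ J`) and `α + β = γ`. -/
def TKK.component (γ : I ⊕ J → ℤ) : Submodule k (TKK k I J D) :=
  Submodule.span k
    ({X | ∃ i j a, eps (.inl i) - eps (.inr j) = γ ∧ X = TKK.ofPos k (Matrix.single i j a)} ∪
     {X | ∃ i j a, eps (.inr j) - eps (.inl i) = γ ∧ X = TKK.ofNeg k (Matrix.single j i a)} ∪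
     {X | ∃ i j l m a b, (eps (.inl i) - eps (.inr j)) + (eps (.inr l) - eps (.inl m)) = γ ∧
        X = TKK.ofDelta k (Matrix.single i j a) (Matrix.single l m b)})

variable {k} in
/-- The root vectors `E_{pq}(a)`, `p ≠ q`, of `TKK(M(1, J, D))`, where `inl 0` is the row index and
the `inr j` are the column indices: `E_{1j}(a) ∈ V⁺`, `E_{j1}(a) ∈ V⁻` are matrices, and
`E_{ji}(a) = -δ(E_{1i}(a), E_{j1}(1))` for `i ≠ j` in `J`. The values at `p = q` are not used. -/
def TKK.rootVector : Fin 1 ⊕ J → Fin 1 ⊕ J → D → TKK k (Fin 1) J D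
  | .inl i, .inr j, a => TKK.ofPos k (Matrix.single i j a)
  | .inr j, .inl i, a => TKK.ofNeg k (Matrix.single j i a)
  | .inr j, .inr i, a => -TKK.ofDelta k (Matrix.single 0 i a) (Matrix.single j 0 1)
  | .inl _, .inl _, _ => 0

end Grading

/-! ### The Lie algebra uce(L) -/

section UCE

variable (k : Type*) [CommRing k] (L : Type*) [LieRing L] [LieAlgebra k L]

/-- The relations of `uce(L)`: the elements `x ⊗ x`, which define `L ∧ L` as a quotient
of `L ⊗ L`, and the elements `x ⊗ [y, z] + y ⊗ [z, x] + z ⊗ [x, y]`. -/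
def uceRelations : Submodule k (L ⊗[k] L) :=
  Submodule.span k
    ({t | ∃ x : L, t = x ⊗ₜ[k] x} ∪
     {t | ∃ x y z : L, t = x ⊗ₜ[k] ⁅y, z⁆ + y ⊗ₜ[k] ⁅z, x⁆ + z ⊗ₜ[k] ⁅x, y⁆})

/-- `uce(L)`, the quotient of `L ∧ L` by the submodule generated by all
`x ∧ [y, z] + y ∧ [z, x] + z ∧ [x, y]`. -/
def UCE : Type _ := (L ⊗[k] L) ⧸ uceRelations k L

namespace UCE

instance : AddCommGroup (UCE k L) := inferInstanceAs (AddCommGroup ((L ⊗[k] L) ⧸ uceRelations k L))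

instance : Module k (UCE k L) := inferInstanceAs (Module k ((L ⊗[k] L) ⧸ uceRelations k L))

/-- The quotient map `L ⊗ L → uce(L)`. -/
def mk : L ⊗[k] L →ₗ[k] UCE k L := (uceRelations k L).mkQ

variable {L} in
/-- The class `⟨x, y⟩` of `x ∧ y` in `uce(L)`. -/
def cls (x y : L) : UCE k L := mk k L (x ⊗ₜ[k] y)

variable {L}

theorem cls_self (x : L) : cls k x x = 0 :=
  (Submodule.Quotient.mk_eq_zero _).2 (Submodule.subset_span (Or.inl ⟨x, rfl⟩))

theorem cls_jacobi (x y z : L) : cls k x ⁅y, z⁆ + cls k y ⁅z, x⁆ + cls k z ⁅x, y⁆ = 0 := by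
  have h : mk k L (x ⊗ₜ[k] ⁅y, z⁆ + y ⊗ₜ[k] ⁅z, x⁆ + z ⊗ₜ[k] ⁅x, y⁆) = 0 :=
    (Submodule.Quotient.mk_eq_zero _).2 (Submodule.subset_span (Or.inr ⟨x, y, z, rfl⟩))
  simpa [cls, map_add] using h

theorem cls_add_left (x x' y : L) : cls k (x + x') y = cls k x y + cls k x' y := by
  simp [cls, TensorProduct.add_tmul]

theorem cls_add_right (x y y' : L) : cls k x (y + y') = cls k x y + cls k x y' := by
  simp [cls, TensorProduct.tmul_add]

theorem cls_smul_right (c : k) (x y : L) : cls k x (c • y) = c • cls k x y := by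
  simp [cls]

theorem cls_swap (x y : L) : cls k x y = -cls k y x := by
  have h := cls_self k (x + y)
  rw [cls_add_left, cls_add_right, cls_add_right, cls_self, cls_self, zero_add, add_zero] at h
  exact eq_neg_of_add_eq_zero_left h

variable (L)

/-- The bracket of `L` as a linear map `L ⊗ L → L`. -/
def lieMap : L ⊗[k] L →ₗ[k] L := TensorProduct.lift (LieModule.toEnd k L L : L →ₗ[k] Module.End k L)

/-- The canonical map `u : uce(L) → L`, `⟨x, y⟩ ↦ [x, y]`. -/
def toLie : UCE k L →ₗ[k] L :=
  (uceRelations k L).liftQ (lieMap k L) (by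
    rw [uceRelations, Submodule.span_le]
    rintro t (⟨x, rfl⟩ | ⟨x, y, z, rfl⟩)
    · simp [lieMap]
    · simpa [lieMap] using lie_jacobi x y z)

variable {L}

@[simp] theorem toLie_cls (x y : L) : toLie k L (cls k x y) = ⁅x, y⁆ := by
  rfl

/-- The bracket `[X, Y] = ⟨u(X), u(Y)⟩` of `uce(L)`. -/
instance : Bracket (UCE k L) (UCE k L) where
  bracket X Y := cls k (toLie k L X) (toLie k L Y)

theorem lie_def (X Y : UCE k L) : ⁅X, Y⁆ = cls k (toLie k L X) (toLie k L Y) := rfl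

instance : LieRing (UCE k L) where
  add_lie X Y Z := by simp only [lie_def, map_add, cls_add_left]
  lie_add X Y Z := by simp only [lie_def, map_add, cls_add_right]
  lie_self X := cls_self k _
  leibniz_lie X Y Z := by
    simp only [lie_def, toLie_cls]
    have h := cls_jacobi k (toLie k L X) (toLie k L Y) (toLie k L Z)
    rw [cls_swap k ⁅toLie k L X, toLie k L Y⁆, ← lie_skew (toLie k L X) (toLie k L Z)]
    have e : cls k (toLie k L Y) (-⁅toLie k L Z, toLie k L X⁆) =
        -cls k (toLie k L Y) ⁅toLie k L Z, toLie k L X⁆ := by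
      rw [← neg_one_smul k, cls_smul_right, neg_one_smul]
    rw [e, ← sub_eq_zero, ← h]
    abel

instance : LieAlgebra k (UCE k L) where
  lie_smul c X Y := by simp only [lie_def, map_smul, cls_smul_right]

/-- For a Lie algebra `L` graded by an abelian group `Γ`, with components `L_δ = A δ`, the component
`uce(L)_γ = ∑_δ ⟨L_δ, L_{γ - δ}⟩` of the induced grading of `uce(L)`. -/
def component {Γ : Type*} [AddCommGroup Γ] (A : Γ → Submodule k L) (γ : Γ) :
    Submodule k (UCE k L) :=
  Submodule.span k {t | ∃ δ : Γ, ∃ x ∈ A δ, ∃ y ∈ A (γ - δ), t = cls k x y}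

end UCE

end UCE

/-! ### The algebra D_2 and the Lie algebra of type A_3 -/

section Coordinates

variable (k : Type*) [CommRing k] (D : Type*) [Ring D] [Algebra k D]

/-- The two-sided ideal of `D` generated by `2 D` and `[D, D]`. -/
def idealTwo : TwoSidedIdeal D :=
  TwoSidedIdeal.span ({c | ∃ a : D, c = 2 * a} ∪ {c | ∃ a b : D, c = a * b - b * a})

/-- The `k`-algebra `D_2`, the quotient of `D` by the ideal generated by `2 D` and `[D, D]`. -/
abbrev DTwo : Type _ := (idealTwo D).ringCon.Quotient

/-- The quotient map `D → D_2`, `a ↦ ā`. -/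
def DTwo.mk : D →ₐ[k] DTwo D := (idealTwo D).ringCon.mkₐ k

/-- The Lie algebra `L = TKK(M(1, 3, D))`. -/
abbrev LieA3 : Type _ := TKK k (Fin 1) (Fin 3) D

/-- The index set of the root system `A_3`: the row index `1` and the three column indices. -/
abbrev IndexA3 : Type := Fin 1 ⊕ Fin 3

/-- The component `uce(L)_γ` of `uce(L)`, `L = TKK(M(1, 3, D))`, for the grading induced by
the root grading of `L`. -/
def uceComponent (γ : IndexA3 → ℤ) : Submodule k (UCE k (LieA3 k D)) :=
  UCE.component k (TKK.component k (Fin 1) (Fin 3) D) γ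

/-- The vectors `ε_1, ε_2, ε_3, ε_4` (numbered from `0` to `3` here) of the root system `A_3`;
the first one belongs to the row index. -/
def epsA3 : Fin 4 → (IndexA3 → ℤ) := ![eps (.inl 0), eps (.inr 0), eps (.inr 1), eps (.inr 2)]

/-- The six elements `±(ε_1 - ε_2 + ε_3 - ε_4)`, `±(ε_1 - ε_2 - ε_3 + ε_4)`,
`±(ε_1 + ε_2 - ε_3 - ε_4)`. -/
def sixSums : Set (IndexA3 → ℤ) :=
  {epsA3 0 - epsA3 1 + epsA3 2 - epsA3 3, -(epsA3 0 - epsA3 1 + epsA3 2 - epsA3 3),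
   epsA3 0 - epsA3 1 - epsA3 2 + epsA3 3, -(epsA3 0 - epsA3 1 - epsA3 2 + epsA3 3),
   epsA3 0 + epsA3 1 - epsA3 2 - epsA3 3, -(epsA3 0 + epsA3 1 - epsA3 2 - epsA3 3)}

end Coordinates

/-! The root vectors multiply like matrix units: [E_pq(a), E_qr(b)] = E_pr(ab), and non-composable
ones commute. So each is a bracket through any third index, and the Jacobi relation moves factors
across ⟨·,·⟩.

For a root, this makes every element of uce(L)_α equal to some ⟨E_pr(a), E_rq(1)⟩ with r fixed
(`cls_chain`, `cls_cartan_mem`). Its image under u is E_pq(a), so u is injective there. For a weight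
outside R, root vectors sharing a row or a column pair to zero. Only four distinct indices remain,
and these give exactly the degenerate sums.

For a degenerate weight with rows p, q and columns r, s put ψ(a) = ⟨E_pr(a), E_qs(1)⟩. Factoring
E_pr through q and through s gives ψ = -ψ and ψ(abc) = ψ(acb). Every pairing of that weight is ψ(ab)
or -ψ(ba), so the component is a quotient of D_2 (`cls_opposite_eq_zero`).

Nothing more collapses, because there is a D_2-valued cocycle. Modulo the ideal, L maps to traceless
4 × 4 matrices over D_2, compatibly with brackets off the diagonal (`matrixMap_lie_apply`,
`trace_matrixMap`). There the polar form of a 2 × 2 minor with disjoint row and column sets is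
alternating and a cocycle in characteristic two (`crossPairing_cocycle`), and it sends ψ(a) to the
class of a. -/

/-! ### Elementary families and relations in `uce(L)` -/

section Elementary

variable {k : Type*} [CommRing k] {D : Type*} [Ring D] [Algebra k D]
  {L : Type*} [LieRing L] [LieAlgebra k L] {ι : Type*}

/-- A family of linear maps `E p q : D → L` that satisfies the Steinberg relations. -/
structure IsElementaryFamily (E : ι → ι → D →ₗ[k] L) : Prop where
  lie_mul : ∀ {p q r : ι}, p ≠ q → q ≠ r → p ≠ r → ∀ a b : D,
    ⁅E p q a, E q r b⁆ = E p r (a * b)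
  lie_eq_zero : ∀ {p q r s : ι}, p ≠ q → r ≠ s → q ≠ r → p ≠ s → ∀ a b : D,
    ⁅E p q a, E r s b⁆ = 0

namespace UCE

variable (k)

theorem cls_zero_left (x : L) : cls k 0 x = 0 := by simp [cls]

theorem cls_zero_right (x : L) : cls k x 0 = 0 := by simp [cls]

theorem cls_neg_right (x y : L) : cls k x (-y) = -cls k x y := by simp [cls, TensorProduct.tmul_neg]

theorem cls_lie_left (x y z : L) : cls k ⁅x, y⁆ z = cls k x ⁅y, z⁆ - cls k y ⁅x, z⁆ := by
  have h := cls_jacobi k x y z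
  rw [← lie_skew z x, cls_neg_right, cls_swap k z] at h
  rw [← sub_eq_zero, ← neg_eq_zero, ← h]
  abel

theorem cls_lie_right (x y z : L) : cls k x ⁅y, z⁆ = cls k ⁅x, y⁆ z + cls k y ⁅x, z⁆ := by
  rw [cls_lie_left]; abel

/-- `x ↦ ⟨x, y⟩` as a linear map. -/
def clsLeft (y : L) : L →ₗ[k] UCE k L := mk k L ∘ₗ (TensorProduct.mk k L L).flip y

@[simp] theorem clsLeft_apply (x y : L) : clsLeft k y x = cls k x y := rfl

/-- `uce(L)_γ` is spanned by the classes of the generators of the components of `L`. -/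
theorem component_le_of_span {Γ : Type*} [AddCommGroup Γ] {A : Γ → Submodule k L} {G : Γ → Set L}
    (hA : ∀ δ, A δ ≤ Submodule.span k (G δ)) {γ : Γ} {N : Submodule k (UCE k L)}
    (h : ∀ δ ε, δ + ε = γ → ∀ x ∈ G δ, ∀ y ∈ G ε, cls k x y ∈ N) : component k A γ ≤ N := by
  refine Submodule.span_le.2 ?_
  rintro _ ⟨δ, x, hx, y, hy, rfl⟩
  replace hx := hA _ hx
  replace hy := hA _ hy
  have hδ : δ + (γ - δ) = γ := by abel
  show cls k x y ∈ N
  induction hx, hy using Submodule.span_induction₂ with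
  | mem_mem x y hx hy => exact h _ _ hδ x hx y hy
  | zero_left y _ => rw [cls_zero_left]; exact zero_mem _
  | zero_right x _ => rw [cls_zero_right]; exact zero_mem _
  | add_left x y z _ _ _ h₁ h₂ => rw [cls_add_left]; exact add_mem h₁ h₂
  | add_right x y z _ _ _ h₁ h₂ => rw [cls_add_right]; exact add_mem h₁ h₂
  | smul_left r x y _ _ h =>
    rw [← clsLeft_apply, map_smul]; exact Submodule.smul_mem _ _ h
  | smul_right r x y _ _ h => rw [cls_smul_right]; exact Submodule.smul_mem _ _ h

theorem cls_mem_component {Γ : Type*} [AddCommGroup Γ] {A : Γ → Submodule k L} {δ ε γ : Γ}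
    {x y : L} (hx : x ∈ A δ) (hy : y ∈ A ε) (h : δ + ε = γ) : cls k x y ∈ component k A γ :=
  Submodule.subset_span ⟨δ, x, hx, y, by rwa [← h, add_sub_cancel_left], rfl⟩

end UCE

namespace IsElementaryFamily

open UCE

variable {E : ι → ι → D →ₗ[k] L} (hE : IsElementaryFamily E)
include hE

/-- The unit of D lets any root vector be split at any intermediate index; the vanishing lemmas
below rest on this. -/
theorem eq_lie {p q r : ι} (hpq : p ≠ q) (hqr : q ≠ r) (hpr : p ≠ r) (a : D) :
    E p r a = ⁅E p q a, E q r 1⁆ := by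
  rw [hE.lie_mul hpq hqr hpr, mul_one]

/-- The product of three composable root vectors is associative in `uce(L)`. -/
theorem cls_mul_left {p q r s : ι} (hpq : p ≠ q) (hpr : p ≠ r) (hps : p ≠ s) (hqr : q ≠ r)
    (hqs : q ≠ s) (hrs : r ≠ s) (a b c : D) :
    cls k (E p r (a * b)) (E r q c) = cls k (E p s a) (E s q (b * c)) := by
  rw [← hE.lie_mul hps hrs.symm hpr, cls_lie_left, hE.lie_mul hrs.symm hqr.symm hqs.symm,
    hE.lie_eq_zero hps hqr.symm hrs.symm hpq, cls_zero_right, sub_zero]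

/-- Changing the intermediate index carries the right factor over to the left one. When r = s, a
detour through a further index t does the same. -/
theorem cls_chain {p q r s : ι} (hpq : p ≠ q) (hpr : p ≠ r) (hqr : q ≠ r) (hps : p ≠ s)
    (hqs : q ≠ s) (h4 : ∀ p q r : ι, ∃ t, t ≠ p ∧ t ≠ q ∧ t ≠ r) (a b : D) :
    cls k (E p r a) (E r q b) = cls k (E p s (a * b)) (E s q 1) := by
  have key : ∀ r s, p ≠ r → q ≠ r → p ≠ s → q ≠ s → r ≠ s → ∀ a b,
      cls k (E p r a) (E r q b) = cls k (E p s (a * b)) (E s q 1) := by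
    intro r s hpr hqr hps hqs hrs a b
    have h := hE.cls_mul_left hpq hps hpr hqs hqr hrs.symm a b 1
    rw [mul_one] at h
    exact h.symm
  rcases eq_or_ne r s with rfl | hrs
  · obtain ⟨t, htp, htq, htr⟩ := h4 p q r
    rw [key r t hpr hqr htp.symm htq.symm htr.symm, key t r htp.symm htq.symm hpr hqr htr,
      mul_one]
  · exact key r s hpr hqr hps hqs hrs a b

/-- Split E_pq(a) at t: neither factor is composable with the second argument, so Jacobi gives 0.
The same argument settles a common row and a common column, with t outside all three indices. -/
theorem cls_self_root {p q t : ι} (hpq : p ≠ q) (htp : t ≠ p) (htq : t ≠ q) (a b : D) :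
    cls k (E p q a) (E p q b) = 0 := by
  rw [hE.eq_lie htp.symm htq hpq a, cls_lie_left, hE.lie_eq_zero htq hpq hpq.symm htq,
    hE.lie_eq_zero htp.symm hpq htp hpq, cls_zero_right, cls_zero_right, sub_zero]

theorem cls_same_row {p q r t : ι} (hpq : p ≠ q) (hpr : p ≠ r) (htp : t ≠ p) (htq : t ≠ q)
    (htr : t ≠ r) (a b : D) : cls k (E p q a) (E p r b) = 0 := by
  rw [hE.eq_lie htp.symm htq hpq a, cls_lie_left, hE.lie_eq_zero htq hpr hpq.symm htr,
    hE.lie_eq_zero htp.symm hpr htp hpr, cls_zero_right, cls_zero_right, sub_zero]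

theorem cls_same_column {p q r t : ι} (hpq : p ≠ q) (hrq : r ≠ q) (htp : t ≠ p) (htq : t ≠ q)
    (htr : t ≠ r) (a b : D) : cls k (E p q a) (E r q b) = 0 := by
  rw [hE.eq_lie htp.symm htq hpq a, cls_lie_left, hE.lie_eq_zero htq hrq hrq.symm htq,
    hE.lie_eq_zero htp.symm hrq htr hpq, cls_zero_right, cls_zero_right, sub_zero]

/-- `[E_pq, E_qp]` normalizes every root space. -/
theorem lie_lie_mem {i j p q : ι} (hij : i ≠ j) (hpq : p ≠ q)
    (h4 : ∀ p q r : ι, ∃ t, t ≠ p ∧ t ≠ q ∧ t ≠ r) (a b c : D) :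
    ⁅⁅E i j a, E j i b⁆, E p q c⁆ ∈ LinearMap.range (E p q) := by
  -- Away from ±(ε_i - ε_j), ad E_ji sends E_pq to zero or to another root vector, which ad E_ij
  -- brings back.
  have key : ∀ p q : ι, p ≠ q → ¬(p = i ∧ q = j) → ¬(p = j ∧ q = i) → ∀ c,
      ⁅⁅E i j a, E j i b⁆, E p q c⁆ ∈ LinearMap.range (E p q) := by
    have half : ∀ i j p q : ι, i ≠ j → p ≠ q → ¬(p = i ∧ q = j) → ¬(p = j ∧ q = i) → ∀ a b c,
        ⁅E i j a, ⁅E j i b, E p q c⁆⁆ ∈ LinearMap.range (E p q) := by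
      intro i j p q hij hpq h₁ h₂ a b c
      by_cases hip : i = p
      · subst hip
        have hjq : j ≠ q := fun h => h₁ ⟨rfl, h.symm⟩
        rw [hE.lie_mul hij.symm hpq hjq, hE.lie_mul hij hjq hpq]
        exact ⟨_, rfl⟩
      by_cases hjq : j = q
      · subst hjq
        rw [← lie_skew (E j i b), hE.lie_mul hpq hij.symm (Ne.symm hip), lie_neg, lie_skew,
          hE.lie_mul (Ne.symm hip) hij hpq]
        exact ⟨_, rfl⟩
      rw [hE.lie_eq_zero hij.symm hpq hip hjq, lie_zero]
      exact zero_mem _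
    intro p q hpq h₁ h₂ c
    rw [lie_lie]
    exact sub_mem (half i j p q hij hpq h₁ h₂ a b c) (half j i p q hij.symm hpq h₂ h₁ b a c)
  by_cases h : (p = i ∧ q = j) ∨ (p = j ∧ q = i)
  -- For ±(ε_i - ε_j) itself, split E_pq at t; the bracket acts as a derivation, and both factors
  -- fall under `key`.
  · obtain ⟨t, htp, htq, -⟩ := h4 p q q
    rw [hE.eq_lie htp.symm htq hpq, leibniz_lie]
    obtain ⟨x, hx⟩ := key p t htp.symm (by grind) (by grind) c
    obtain ⟨y, hy⟩ := key t q htq (by grind) (by grind) 1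
    rw [← hx, ← hy, hE.lie_mul htp.symm htq hpq, hE.lie_mul htp.symm htq hpq]
    exact add_mem ⟨_, rfl⟩ ⟨_, rfl⟩
  · rw [not_or] at h
    exact key p q hpq h.1 h.2 c

/-- If `h` normalizes the root spaces, then `⟨h, E_pq(c)⟩` has the form `⟨E_pr(a), E_rq(1)⟩`. -/
theorem cls_cartan_mem {h : L} {p q r : ι} (hpq : p ≠ q) (hpr : p ≠ r) (hqr : q ≠ r)
    (h4 : ∀ p q r : ι, ∃ t, t ≠ p ∧ t ≠ q ∧ t ≠ r)
    (hh : ∀ s t, s ≠ t → ∀ c, ⁅h, E s t c⁆ ∈ LinearMap.range (E s t)) (c : D) :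
    cls k h (E p q c) ∈ LinearMap.range (clsLeft k (E r q 1) ∘ₗ E p r) := by
  rw [hE.eq_lie hpr hqr.symm hpq, cls_lie_right]
  obtain ⟨x, hx⟩ := hh p r hpr c
  obtain ⟨y, hy⟩ := hh r q hqr.symm 1
  rw [← hx, ← hy, hE.cls_chain hpq hpr hqr hpr hqr h4 c y]
  exact add_mem ⟨_, rfl⟩ ⟨_, rfl⟩

/-! ### Pairings of degenerate weight: rows p, q and columns r, s -/

section Degenerate

set_option linter.unusedSectionVars false

variable {p q r s : ι} (hpq : p ≠ q) (hpr : p ≠ r) (hps : p ≠ s) (hqr : q ≠ r) (hqs : q ≠ s)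
  (hrs : r ≠ s)
include hpq hpr hps hqr hqs hrs

/-- Here E_pr(ab) is split at q, in `cls_mul_opposite'` at s. Comparing the two splittings yields
all relations of D_2. -/
theorem cls_mul_opposite (a b c : D) :
    cls k (E p r (a * b)) (E q s c) = cls k (E p s (a * c)) (E q r b) := by
  rw [← hE.lie_mul hpq hqr hpr, cls_lie_left, hE.lie_eq_zero hqr hqs hqr.symm hqs,
    hE.lie_mul hpq hqs hps, cls_zero_right, zero_sub, ← cls_swap]

theorem cls_mul_opposite' (a b c : D) :
    cls k (E p r (a * b)) (E q s c) = -cls k (E p s a) (E q r (c * b)) := by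
  rw [← hE.lie_mul hps hrs.symm hpr, cls_lie_left, hE.lie_eq_zero hps hqs hqs.symm hps,
    ← lie_skew, hE.lie_mul hqs hrs.symm hqr, cls_zero_right, sub_zero, cls_neg_right]

theorem cls_opposite_swap (a b : D) :
    cls k (E p s a) (E q r b) = cls k (E p r (a * b)) (E q s 1) := by
  have h := hE.cls_mul_opposite hpq hpr hps hqr hqs hrs a b 1
  rw [mul_one] at h
  exact h.symm

theorem cls_opposite (a b : D) :
    cls k (E p r a) (E q s b) = cls k (E p r (a * b)) (E q s 1) := by
  rw [hE.cls_opposite_swap hpq hps hpr hqs hqr hrs.symm,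
    hE.cls_opposite_swap hpq hpr hps hqr hqs hrs, mul_one]

/-- Splitting at s exchanges the columns with a minus sign, splitting at q without one; hence 2 is
killed. -/
theorem cls_opposite_neg (a : D) :
    -cls k (E p r a) (E q s 1) = cls k (E p r a) (E q s 1) := by
  have h := hE.cls_mul_opposite' hpq hpr hps hqr hqs hrs a 1 1
  rw [hE.cls_opposite_swap hpq hpr hps hqr hqs hrs, mul_one, mul_one, mul_one] at h
  exact h.symm

/-- Both sides evaluate ⟨E_pr(ab), E_qs(c)⟩: directly, and after exchanging the columns. -/
theorem cls_opposite_mul_comm (a b c : D) :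
    cls k (E p r (a * b * c)) (E q s 1) = cls k (E p r (a * c * b)) (E q s 1) := by
  rw [← hE.cls_opposite hpq hpr hps hqr hqs hrs (a * b) c,
    hE.cls_mul_opposite hpq hpr hps hqr hqs hrs,
    hE.cls_opposite_swap hpq hpr hps hqr hqs hrs]

theorem cls_opposite_eq_zero {c : D} (hc : c ∈ idealTwo D) :
    cls k (E p r c) (E q s 1) = 0 := by
  have hcomm := hE.cls_opposite_mul_comm hpq hpr hps hqr hqs hrs
  have hneg := hE.cls_opposite_neg hpq hpr hps hqr hqs hrs
  set ψ : D →ₗ[k] UCE k L := clsLeft k (E q s 1) ∘ₗ E p r with hψ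
  change ∀ a b c, ψ (a * b * c) = ψ (a * c * b) at hcomm
  change ∀ a, -ψ a = ψ a at hneg
  -- The largest two-sided ideal inside the kernel of ψ; it suffices that it contains the generators
  -- of `idealTwo D`.
  let I : TwoSidedIdeal D := TwoSidedIdeal.mk' {x | ∀ a b, ψ (a * x * b) = 0}
    (fun a b => by simp)
    (fun {x y} hx hy a b => by rw [mul_add, add_mul, map_add, hx, hy, add_zero])
    (fun {x} hx a b => by rw [mul_neg, neg_mul, map_neg, hx, neg_zero])
    (fun {x y} hy a b => by rw [← mul_assoc a, hy])
    (fun {x y} hx a b => by rw [← mul_assoc a, mul_assoc _ y, hx])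
  have hI : idealTwo D ≤ I := by
    refine TwoSidedIdeal.span_le.2 ?_
    rintro _ (⟨x, rfl⟩ | ⟨x, y, rfl⟩)
    · refine (TwoSidedIdeal.mem_mk' ..).2 fun a b => ?_
      rw [two_mul, mul_add, add_mul, map_add]
      nth_rewrite 1 [← hneg]
      exact neg_add_cancel _
    · refine (TwoSidedIdeal.mem_mk' ..).2 fun a b => ?_
      -- Both axyb and ayxb have the same ψ as aybx.
      rw [mul_sub, sub_mul, map_sub, sub_eq_zero, ← mul_assoc, ← mul_assoc, mul_assoc _ y b, hcomm,
        hcomm (a * y) x b, ← mul_assoc]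
  have h := (TwoSidedIdeal.mem_mk' ..).1 (hI hc) 1 1
  rwa [one_mul, mul_one] at h

end Degenerate

end IsElementaryFamily

end Elementary

/-! ### The root vectors of `TKK(M(1, J, D))` -/

namespace TKK

section Inclusions

set_option linter.unusedSectionVars false

variable {k : Type*} [CommRing k] {I J D : Type*} [Fintype I] [Fintype J] [DecidableEq I]
  [DecidableEq J] [Ring D] [Algebra k D]

theorem innerDelta_zero_left (y : Matrix J I D) :
    innerDelta k (0 : Matrix I J D) y = 0 := by
  simpa using innerDelta_smul_left k 0 (0 : Matrix I J D) y

theorem innerDelta_zero_right (x : Matrix I J D) :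
    innerDelta k x (0 : Matrix J I D) = 0 := by
  simpa using innerDelta_smul_right k 0 x (0 : Matrix J I D)

theorem lie_ofPos_ofPos (x y : Matrix I J D) : ⁅ofPos k x, ofPos k y⁆ = 0 := by
  refine TKK.ext ?_ (Subtype.ext ?_) ?_ <;> simp [ofPos, innerDelta_zero_right]

theorem lie_ofNeg_ofNeg (x y : Matrix J I D) : ⁅ofNeg k x, ofNeg k y⁆ = 0 := by
  refine TKK.ext ?_ (Subtype.ext ?_) ?_ <;> simp [ofNeg, innerDelta_zero_left]

theorem lie_ofPos_ofNeg (x : Matrix I J D) (y : Matrix J I D) :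
    ⁅ofPos k x, ofNeg k y⁆ = ofDelta k x y := by
  refine TKK.ext ?_ (Subtype.ext ?_) ?_ <;> simp [ofPos, ofNeg, ofDelta, innerDelta_zero_left]

theorem lie_ofDelta_ofPos (x z : Matrix I J D) (y : Matrix J I D) :
    ⁅ofDelta k x y, ofPos k z⁆ = ofPos k (x * y * z + z * y * x) := by
  refine TKK.ext ?_ (Subtype.ext ?_) ?_
  · simp [ofPos, ofDelta, innerDelta]
  · simp [ofPos, ofDelta, innerDelta_zero_right]
  · simp [ofPos, ofDelta]

theorem lie_ofDelta_ofNeg (x : Matrix I J D) (y z : Matrix J I D) :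
    ⁅ofDelta k x y, ofNeg k z⁆ = ofNeg k (-(y * x * z + z * x * y)) := by
  refine TKK.ext ?_ (Subtype.ext ?_) ?_
  · simp [ofNeg, ofDelta]
  · simp [ofNeg, ofDelta, innerDelta_zero_left]
  · simp [ofNeg, ofDelta, innerDelta]

theorem lie_ofDelta_ofDelta (x z : Matrix I J D) (y w : Matrix J I D) :
    ⁅ofDelta k x y, ofDelta k z w⁆ =
      ofDelta k (x * y * z + z * y * x) w + ofDelta k z (-(y * x * w + w * x * y)) := by
  rw [← lie_ofPos_ofNeg z w, leibniz_lie, lie_ofDelta_ofPos, lie_ofDelta_ofNeg, lie_ofPos_ofNeg,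
    lie_ofPos_ofNeg]

theorem ofPos_zero : ofPos k (0 : Matrix I J D) = 0 := rfl

theorem ofNeg_zero : ofNeg k (0 : Matrix J I D) = 0 := rfl

theorem ofNeg_neg (y : Matrix J I D) : ofNeg k (-y) = -ofNeg k y :=
  eq_neg_of_add_eq_zero_left
    (TKK.ext (add_zero 0) (add_zero 0) (_root_.neg_add_cancel y))

theorem ofDelta_zero_left (y : Matrix J I D) : ofDelta k (0 : Matrix I J D) y = 0 :=
  TKK.ext rfl (Subtype.ext (innerDelta_zero_left y)) rfl

theorem ofDelta_zero_right (x : Matrix I J D) : ofDelta k x (0 : Matrix J I D) = 0 :=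
  TKK.ext rfl (Subtype.ext (innerDelta_zero_right x)) rfl

theorem ofDelta_add_left (x x' : Matrix I J D) (y : Matrix J I D) :
    ofDelta k (x + x') y = ofDelta k x y + ofDelta k x' y :=
  TKK.ext (add_zero 0).symm (Subtype.ext (innerDelta_add_left k x x' y)) (add_zero 0).symm

theorem ofDelta_smul_left (c : k) (x : Matrix I J D) (y : Matrix J I D) :
    ofDelta k (c • x) y = c • ofDelta k x y :=
  TKK.ext (smul_zero c).symm (Subtype.ext (innerDelta_smul_left k c x y)) (smul_zero c).symm

theorem ofDelta_neg_right (x : Matrix I J D) (y : Matrix J I D) :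
    ofDelta k x (-y) = -ofDelta k x y := by
  rw [eq_neg_iff_add_eq_zero]
  refine TKK.ext (add_zero 0) (Subtype.ext ?_) (add_zero 0)
  refine (innerDelta_add_right k x (-y) y).symm.trans ?_
  rw [neg_add_cancel, innerDelta_zero_right]
  rfl

/-- For j ≠ l the product xy vanishes, so δ(x, y) depends only on yx = E_lj(ba). This is why the
second entry in the definition of E_lj can be normalized to 1. -/
theorem ofDelta_single_of_ne {i : I} {j l : J} (h : j ≠ l) (a b : D) :
    ofDelta k (Matrix.single i j a) (Matrix.single l i b) =
      ofDelta k (Matrix.single i j (b * a)) (Matrix.single l i 1) := by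
  refine TKK.ext rfl (Subtype.ext (Prod.ext (LinearMap.ext fun z => ?_)
    (LinearMap.ext fun z => ?_))) rfl <;>
  simp [ofDelta, innerDelta, h, Matrix.mul_assoc _ (Matrix.single _ _ _) (Matrix.single _ _ _)]

end Inclusions

variable {k : Type*} [CommRing k] {J D : Type*} [Fintype J] [DecidableEq J] [Ring D] [Algebra k D]

variable (k J D) in
/-- The root vectors as linear maps. -/
def rootMap (p q : Fin 1 ⊕ J) : D →ₗ[k] TKK k (Fin 1) J D where
  toFun := rootVector p q
  map_add' a b := by
    rcases p with p | p <;> rcases q with q | q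
    · exact (add_zero 0).symm
    · refine TKK.ext ?_ (Subtype.ext ?_) ?_ <;> simp [rootVector, ofPos, Matrix.single_add]
    · refine TKK.ext ?_ (Subtype.ext ?_) ?_ <;> simp [rootVector, ofNeg, Matrix.single_add]
    · simp only [rootVector, Matrix.single_add, ofDelta_add_left, _root_.neg_add]
  map_smul' c a := by
    rcases p with p | p <;> rcases q with q | q
    · exact (smul_zero c).symm
    · refine TKK.ext ?_ (Subtype.ext ?_) ?_ <;> simp [rootVector, ofPos, Matrix.smul_single]
    · refine TKK.ext ?_ (Subtype.ext ?_) ?_ <;> simp [rootVector, ofNeg, Matrix.smul_single]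
    · simp only [rootVector, ← Matrix.smul_single, ofDelta_smul_left, smul_neg, RingHom.id_apply]

@[simp] theorem rootMap_apply (p q : Fin 1 ⊕ J) (a : D) :
    rootMap k J D p q a = rootVector p q a := rfl

/-- The minus sign in E_ji(a) = -δ(E_1i(a), E_j1(1)) gives all four possible cases the coefficient
+1; the others would repeat the single row index. -/
theorem lie_rootVector_mul {p q r : Fin 1 ⊕ J} (hpq : p ≠ q) (hqr : q ≠ r) (hpr : p ≠ r)
    (a b : D) : ⁅(rootVector p q a : TKK k (Fin 1) J D), rootVector (k := k) q r b⁆ = rootVector p r (a * b) := by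
  rcases p with p | p <;> rcases q with q | q <;> rcases r with r | r
  · exact absurd (congrArg Sum.inl (Subsingleton.elim p q)) hpq
  · exact absurd (congrArg Sum.inl (Subsingleton.elim p q)) hpq
  · exact absurd (congrArg Sum.inl (Subsingleton.elim p r)) hpr
  · obtain rfl := Subsingleton.elim p 0
    have h : q ≠ r := fun h => hqr (congrArg _ h)
    simp only [rootVector]
    rw [lie_neg, lie_skew, lie_ofDelta_ofPos]
    simp [h.symm]
  · exact absurd (congrArg Sum.inl (Subsingleton.elim q r)) hqr
  · obtain rfl := Subsingleton.elim q 0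
    have h : p ≠ r := fun h => hpr (congrArg _ h)
    simp only [rootVector]
    rw [← lie_skew, lie_ofPos_ofNeg, ofDelta_single_of_ne h.symm]
  · obtain rfl := Subsingleton.elim r 0
    have h : p ≠ q := fun h => hpq (congrArg _ h)
    simp only [rootVector]
    rw [_root_.neg_lie, lie_ofDelta_ofNeg]
    simp [h.symm, ofNeg_neg]
  · have h₁ : p ≠ q := fun h => hpq (congrArg _ h)
    have h₂ : q ≠ r := fun h => hqr (congrArg _ h)
    have h₃ : p ≠ r := fun h => hpr (congrArg _ h)
    simp only [rootVector]
    rw [_root_.neg_lie, lie_neg, neg_neg, lie_ofDelta_ofDelta]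
    simp [h₁.symm, h₃.symm, ofDelta_zero_left, ofDelta_neg_right]
    rw [ofDelta_single_of_ne h₃.symm]

theorem lie_rootVector_eq_zero {p q r s : Fin 1 ⊕ J} (hpq : p ≠ q) (hrs : r ≠ s) (hqr : q ≠ r)
    (hps : p ≠ s) (a b : D) : ⁅(rootVector p q a : TKK k (Fin 1) J D), rootVector (k := k) r s b⁆ = 0 := by
  rcases p with p | p <;> rcases q with q | q <;> rcases r with r | r <;> rcases s with s | s <;>
    simp only [rootVector, zero_lie, lie_zero]
  · exact lie_ofPos_ofPos _ _
  · exact absurd (congrArg Sum.inl (Subsingleton.elim p s)) hps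
  · have h₁ : q ≠ r := fun h => hqr (congrArg _ h)
    have h₂ : r ≠ s := fun h => hrs (congrArg _ h)
    rw [lie_neg, lie_skew, lie_ofDelta_ofPos]
    simp [h₁, h₂.symm, ofPos_zero]
  · exact absurd (congrArg Sum.inl (Subsingleton.elim q r)) hqr
  · exact lie_ofNeg_ofNeg _ _
  · have h₁ : r ≠ s := fun h => hrs (congrArg _ h)
    have h₂ : p ≠ s := fun h => hps (congrArg _ h)
    rw [lie_neg, lie_skew, lie_ofDelta_ofNeg]
    simp [h₁.symm, h₂.symm, ofNeg_zero]
  · have h₁ : p ≠ q := fun h => hpq (congrArg _ h)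
    have h₂ : p ≠ s := fun h => hps (congrArg _ h)
    rw [_root_.neg_lie, lie_ofDelta_ofPos]
    simp [h₁.symm, h₂.symm, ofPos_zero]
  · have h₁ : p ≠ q := fun h => hpq (congrArg _ h)
    have h₂ : q ≠ r := fun h => hqr (congrArg _ h)
    rw [_root_.neg_lie, lie_ofDelta_ofNeg]
    simp [h₂, h₁.symm, ofNeg_zero]
  · have h₁ : p ≠ q := fun h => hpq (congrArg _ h)
    have h₂ : p ≠ s := fun h => hps (congrArg _ h)
    have h₃ : q ≠ r := fun h => hqr (congrArg _ h)
    rw [_root_.neg_lie, lie_neg, neg_neg, lie_ofDelta_ofDelta]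
    simp [h₃, h₁.symm, h₂.symm, ofDelta_zero_left, ofDelta_zero_right]

variable (k J D) in
theorem isElementaryFamily_rootMap : IsElementaryFamily (rootMap k J D) where
  lie_mul := lie_rootVector_mul
  lie_eq_zero := lie_rootVector_eq_zero

variable (k J D) in
/-- Spanning sets of the homogeneous components of `TKK(M(1, J, D))`. -/
def generators (γ : Fin 1 ⊕ J → ℤ) : Set (TKK k (Fin 1) J D) :=
  {X | ∃ p q a, p ≠ q ∧ eps p - eps q = γ ∧ X = rootMap k J D p q a} ∪
  {X | γ = 0 ∧ ∃ p q a b, p ≠ q ∧ X = ⁅rootMap k J D p q a, rootMap k J D q p b⁆}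

theorem component_le_span_generators (γ : Fin 1 ⊕ J → ℤ) :
    component k (Fin 1) J D γ ≤ Submodule.span k (generators k J D γ) := by
  refine Submodule.span_le.2 ?_
  rintro _ ((⟨i, j, a, h, rfl⟩ | ⟨i, j, a, h, rfl⟩) | ⟨i, j, l, m, a, b, h, rfl⟩)
  · exact Submodule.subset_span (Or.inl ⟨.inl i, .inr j, a, by simp, h, rfl⟩)
  · exact Submodule.subset_span (Or.inl ⟨.inr j, .inl i, a, by simp, h, rfl⟩)
  · obtain rfl := Subsingleton.elim i 0
    obtain rfl := Subsingleton.elim m 0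
    rcases eq_or_ne j l with rfl | hjl
    · refine Submodule.subset_span (Or.inr ⟨?_, .inl 0, .inr j, a, b, by simp, ?_⟩)
      · rw [← h]; abel
      · exact (lie_ofPos_ofNeg _ _).symm
    -- For j ≠ l, δ(E_1j(a), E_l1(b)) = -E_lj(ba).
    · refine Submodule.subset_span (Or.inl ⟨.inr l, .inr j, -(b * a), by simp [hjl.symm], ?_, ?_⟩)
      · rw [← h]; abel
      · rw [map_neg, rootMap_apply, rootVector, neg_neg, ofDelta_single_of_ne hjl]

theorem rootVector_mem_component {p q : Fin 1 ⊕ J} (hpq : p ≠ q) (a : D) :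
    rootVector p q a ∈ component k (Fin 1) J D (eps p - eps q) := by
  rcases p with p | p <;> rcases q with q | q
  · exact absurd (congrArg Sum.inl (Subsingleton.elim p q)) hpq
  · exact Submodule.subset_span (Or.inl (Or.inl ⟨p, q, a, rfl, rfl⟩))
  · exact Submodule.subset_span (Or.inl (Or.inr ⟨q, p, a, rfl, rfl⟩))
  · refine neg_mem (Submodule.subset_span (Or.inr ⟨0, q, p, 0, a, 1, ?_, rfl⟩))
    abel

theorem rootVector_injective {p q : Fin 1 ⊕ J} (hpq : p ≠ q) :
    Function.Injective (rootVector (k := k) (D := D) p q) := by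
  intro a b h
  rcases p with p | p <;> rcases q with q | q
  · exact absurd (congrArg Sum.inl (Subsingleton.elim p q)) hpq
  · simpa [rootVector, ofPos] using congrFun₂ (congrArg TKK.pos h) p q
  · simpa [rootVector, ofNeg] using congrFun₂ (congrArg TKK.neg h) p q
  · have h₁ : p ≠ q := fun h => hpq (congrArg _ h)
    -- Bracketing with E_1p(1) turns E_pq(c) into E_1q(c) in V⁺, where the coefficient can be read
    -- off.
    have h₂ := congrArg (fun X : TKK k (Fin 1) J D => ⁅ofPos k (Matrix.single (0 : Fin 1) p (1 : D)), X⁆) h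
    have key : ∀ c : D, ⁅ofPos k (Matrix.single (0 : Fin 1) p (1 : D)),
        (rootVector (.inr p) (.inr q) c : TKK k (Fin 1) J D)⁆ = ofPos k (Matrix.single 0 q c) := by
      intro c
      have := lie_rootVector_mul (k := k) (J := J) (D := D) (p := .inl 0) (q := .inr p)
        (r := .inr q) (by simp) hpq (by simp) 1 c
      rwa [one_mul] at this
    simp only [key] at h₂
    simpa [ofPos] using congrFun₂ (congrArg TKK.pos h₂) 0 q

end TKK

/-! ### Degenerate sums in type `A_3` -/

section DegenerateSums

set_option linter.unusedSectionVars false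

variable {K : Type*} [Fintype K] [DecidableEq K]

theorem eps_apply (p q : K) : eps p q = if q = p then 1 else 0 := Pi.single_apply p 1 q

theorem corootPairing_eps_sub_eps (γ : K → ℤ) (p q : K) :
    corootPairing γ (eps p - eps q) = γ p - γ q := by
  simp [corootPairing, eps, dotProduct_sub]

/-- As the four indices exhaust K, every coordinate of the sum is ±1. All differences are thus even,
and the pair p, q attains 2. -/
theorem isDegenerateSum_of_distinct {p q r s : K} (hpq : p ≠ q) (hpr : p ≠ r) (hps : p ≠ s)
    (hqr : q ≠ r) (hqs : q ≠ s) (hrs : r ≠ s) (hK : ∀ t : K, t = p ∨ t = q ∨ t = r ∨ t = s) :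
    IsDegenerateSum ((eps p - eps q) + (eps r - eps s)) := by
  refine ⟨⟨_, ⟨p, q, hpq, rfl⟩, _, ⟨r, s, hrs, rfl⟩, ?_, rfl⟩, 2, one_lt_two, ?_, ?_⟩
  · rw [LinearIndependent.pair_iff]
    intro a b h
    have h₁ := congrFun h p
    have h₂ := congrFun h r
    simp [eps_apply, hpq, hpr, hps, hrs, hpr.symm, hqr.symm] at h₁ h₂
    exact ⟨h₁, h₂⟩
  · rintro _ ⟨i, j, -, rfl⟩
    rw [corootPairing_eps_sub_eps]
    rcases hK i with rfl | rfl | rfl | rfl <;> rcases hK j with rfl | rfl | rfl | rfl <;>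
      simp [eps_apply, *, Ne.symm, hpq.symm, hpr.symm, hps.symm, hqr.symm, hqs.symm, hrs.symm]
  · intro m hm
    have h := hm _ ⟨p, q, hpq, rfl⟩
    rw [corootPairing_eps_sub_eps] at h
    simp [eps_apply, hpq, hpr, hps, hqr, hqs, hpq.symm] at h
    exact Nat.le_of_dvd two_pos (by exact_mod_cast h)

/-- Independence excludes the sums 0 and 2α. After any other coincidence of indices, an index
outside the sum provides a coordinate difference ±1, against divisor > 1. -/
theorem IsDegenerateSum.exists_distinct {γ : K → ℤ} (hγ : IsDegenerateSum γ)
    (h4 : ∀ p q r : K, ∃ t, t ≠ p ∧ t ≠ q ∧ t ≠ r) :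
    ∃ p q r s : K, p ≠ q ∧ p ≠ r ∧ p ≠ s ∧ q ≠ r ∧ q ≠ s ∧ r ≠ s ∧
      γ = (eps p - eps q) + (eps r - eps s) := by
  obtain ⟨⟨_, ⟨p, q, hpq, rfl⟩, _, ⟨r, s, hrs, rfl⟩, hli, rfl⟩, n, hn, hd, -⟩ := hγ
  rw [LinearIndependent.pair_iff] at hli
  have key : ∀ i j, i ≠ j → ¬ (n : ℤ) ∣ 1 ∧ (n : ℤ) ∣ corootPairing
      ((eps p - eps q) + (eps r - eps s)) (eps i - eps j) := by
    refine fun i j hij => ⟨fun h => ?_, hd _ ⟨i, j, hij, rfl⟩⟩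
    have := Nat.le_of_dvd one_pos (by exact_mod_cast h)
    omega
  simp only [corootPairing_eps_sub_eps, Pi.add_apply, Pi.sub_apply, eps_apply] at key
  have hne₁ : ¬ (p = s ∧ q = r) := by
    rintro ⟨rfl, rfl⟩
    simpa using hli 1 1 (by simp)
  have hne₂ : ¬ (p = r ∧ q = s) := by
    rintro ⟨rfl, rfl⟩
    simpa using hli 1 (-1) (by simp)
  have hqr : q ≠ r := by
    rintro rfl
    obtain ⟨t, htp, hts, htq⟩ := h4 p s q
    have h := key p t htp.symm
    have hps : p ≠ s := fun h => hne₁ ⟨h, rfl⟩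
    simp [htp, hts, htq, hpq, hps] at h
  have hps : p ≠ s := by
    rintro rfl
    obtain ⟨t, htp, hts, htq⟩ := h4 p r q
    have h := key r t hts.symm
    simp [htp, hts, htq, hrs, hqr.symm] at h
  have hpr : p ≠ r := by
    rintro rfl
    obtain ⟨t, htp, hts, htq⟩ := h4 p s q
    have h := key t q htq
    have hqs : q ≠ s := fun h => hne₂ ⟨rfl, h⟩
    simp [htp, hts, htq, hqr, hqs] at h
  have hqs : q ≠ s := by
    rintro rfl
    obtain ⟨t, htp, hts, htq⟩ := h4 p r q
    have h := key p t htp.symm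
    simp [htp, hts, htq, hpq, hpr] at h
  exact ⟨p, q, r, s, hpq, hpr, hps, hqr, hqs, hrs, rfl⟩

theorem eps_sub_eps_injective {p q p' q' : K} (hpq : p ≠ q)
    (h : eps p - eps q = eps p' - eps q') : p = p' ∧ q = q' := by
  have h₁ := congrFun h p
  have h₂ := congrFun h q
  simp only [Pi.sub_apply, eps_apply] at h₁ h₂
  grind

theorem eps_sub_eps_ne_zero {p q : K} (hpq : p ≠ q) : eps p - eps q ≠ 0 := by
  intro h
  have h₁ := congrFun h p
  simp [eps_apply, hpq] at h₁

/-- A root is the sum of two nonzero roots only if these are composable. -/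
theorem eps_sub_eps_add_eq_root {p q r s i j : K} (hpq : p ≠ q) (hrs : r ≠ s) (hij : i ≠ j)
    (h : (eps p - eps q) + (eps r - eps s) = eps i - eps j) :
    (q = r ∧ p = i ∧ s = j) ∨ (p = s ∧ r = i ∧ q = j) := by
  have h₁ := congrFun h p
  have h₂ := congrFun h q
  have h₃ := congrFun h r
  have h₄ := congrFun h s
  have h₅ := congrFun h i
  have h₆ := congrFun h j
  simp only [Pi.sub_apply, Pi.add_apply, eps_apply] at h₁ h₂ h₃ h₄ h₅ h₆
  grind

/-- The coordinates equal to 1 determine the rows, those equal to -1 the columns, each up to order.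
-/
theorem eps_sub_eps_add_eq_degenerate {p q r s p' q' r' s' : K} (hpq : p ≠ q) (hpr : p ≠ r)
    (hps : p ≠ s) (hqr : q ≠ r) (hqs : q ≠ s) (hrs : r ≠ s)
    (h : (eps p' - eps q') + (eps r' - eps s') = (eps p - eps q) + (eps r - eps s)) :
    ((p' = p ∧ r' = r) ∨ (p' = r ∧ r' = p)) ∧ ((q' = q ∧ s' = s) ∨ (q' = s ∧ s' = q)) := by
  have h₁ := congrFun h p
  have h₂ := congrFun h q
  have h₃ := congrFun h r
  have h₄ := congrFun h s
  simp only [Pi.sub_apply, Pi.add_apply, eps_apply] at h₁ h₂ h₃ h₄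
  grind

end DegenerateSums

section IndexA3

theorem IndexA3.exists_ne (p q r : IndexA3) : ∃ t, t ≠ p ∧ t ≠ q ∧ t ≠ r := by
  revert p q r; decide

theorem IndexA3.eq_or_eq {p q r s : IndexA3} (hpq : p ≠ q) (hpr : p ≠ r) (hps : p ≠ s)
    (hqr : q ≠ r) (hqs : q ≠ s) (hrs : r ≠ s) (t : IndexA3) :
    t = p ∨ t = q ∨ t = r ∨ t = s := by
  have h : ({p, q, r, s} : Finset IndexA3) = Finset.univ := by
    rw [← Finset.card_eq_iff_eq_univ]
    simp [*]
  have ht : t ∈ ({p, q, r, s} : Finset IndexA3) := h ▸ Finset.mem_univ t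
  simpa using ht

set_option synthInstance.maxSize 1000 in
set_option maxRecDepth 10000 in
theorem isDegenerateSum_iff_mem_sixSums (γ : IndexA3 → ℤ) :
    IsDegenerateSum γ ↔ γ ∈ sixSums := by
  constructor
  · intro h
    obtain ⟨p, q, r, s, hpq, hpr, hps, hqr, hqs, hrs, rfl⟩ := h.exists_distinct IndexA3.exists_ne
    -- Otherwise `h` would be reverted with the indices and spoil decidability.
    clear h
    simp only [sixSums, Set.mem_insert_iff, Set.mem_singleton_iff]
    revert p q r s
    decide
  · have key : ∀ p q r s : IndexA3, p ≠ q → p ≠ r → p ≠ s → q ≠ r → q ≠ s → r ≠ s →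
        IsDegenerateSum ((eps p - eps q) + (eps r - eps s)) :=
      fun p q r s hpq hpr hps hqr hqs hrs => isDegenerateSum_of_distinct hpq hpr hps hqr hqs hrs
        (IndexA3.eq_or_eq hpq hpr hps hqr hqs hrs)
    rintro (rfl | rfl | rfl | rfl | rfl | rfl)
    · convert key (.inl 0) (.inr 0) (.inr 1) (.inr 2) (by decide) (by decide) (by decide)
        (by decide) (by decide) (by decide) using 1
      decide
    · convert key (.inr 0) (.inl 0) (.inr 2) (.inr 1) (by decide) (by decide) (by decide)
        (by decide) (by decide) (by decide) using 1
      decide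
    · convert key (.inl 0) (.inr 0) (.inr 2) (.inr 1) (by decide) (by decide) (by decide)
        (by decide) (by decide) (by decide) using 1
      decide
    · convert key (.inr 0) (.inl 0) (.inr 1) (.inr 2) (by decide) (by decide) (by decide)
        (by decide) (by decide) (by decide) using 1
      decide
    · convert key (.inl 0) (.inr 1) (.inr 0) (.inr 2) (by decide) (by decide) (by decide)
        (by decide) (by decide) (by decide) using 1
      decide
    · convert key (.inr 1) (.inl 0) (.inr 2) (.inr 0) (by decide) (by decide) (by decide)
        (by decide) (by decide) (by decide) using 1
      decide

theorem ncard_sixSums : sixSums.ncard = 6 := by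
  have h : sixSums = (({epsA3 0 - epsA3 1 + epsA3 2 - epsA3 3,
      -(epsA3 0 - epsA3 1 + epsA3 2 - epsA3 3), epsA3 0 - epsA3 1 - epsA3 2 + epsA3 3,
      -(epsA3 0 - epsA3 1 - epsA3 2 + epsA3 3), epsA3 0 + epsA3 1 - epsA3 2 - epsA3 3,
      -(epsA3 0 + epsA3 1 - epsA3 2 - epsA3 3)} : Finset (IndexA3 → ℤ)) : Set _) := by
    simp [sixSums]
  rw [h, Set.ncard_coe_finset]
  decide

end IndexA3

/-! ### The cocycles with values in `D_2` -/

section Cocycle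

namespace DTwo

variable {k : Type*} [CommRing k] {D : Type*} [Ring D] [Algebra k D]

theorem mk_surjective : Function.Surjective (mk k D) := Quotient.mk''_surjective

theorem mk_eq_mk {a b : D} : mk k D a = mk k D b ↔ a - b ∈ idealTwo D :=
  ((idealTwo D).ringCon.eq).trans ((idealTwo D).rel_iff a b)

theorem mk_eq_zero {a : D} : mk k D a = 0 ↔ a ∈ idealTwo D := by
  rw [← map_zero (mk k D), mk_eq_mk, sub_zero]

end DTwo

instance DTwo.instCommRing (D : Type*) [Ring D] : CommRing (DTwo D) where
  mul_comm a b := by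
    obtain ⟨a, rfl⟩ := DTwo.mk_surjective (k := ℤ) a
    obtain ⟨b, rfl⟩ := DTwo.mk_surjective (k := ℤ) b
    rw [← map_mul, ← map_mul, DTwo.mk_eq_mk]
    exact TwoSidedIdeal.subset_span (Or.inr ⟨a, b, rfl⟩)

theorem DTwo.two_eq_zero (D : Type*) [Ring D] : (2 : DTwo D) = 0 := by
  rw [← map_ofNat (DTwo.mk ℤ D) 2, DTwo.mk_eq_zero]
  exact TwoSidedIdeal.subset_span (Or.inl ⟨1, (mul_one 2).symm⟩)

theorem DTwo.neg_eq {D : Type*} [Ring D] (a : DTwo D) : -a = a := by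
  rw [neg_eq_iff_add_eq_zero, ← two_mul, DTwo.two_eq_zero, zero_mul]

namespace TKK

set_option linter.unusedSectionVars false

open Matrix

variable {k : Type*} [CommRing k] {J D : Type*} [Fintype J] [DecidableEq J] [Ring D] [Algebra k D]

variable (k J D) in
/-- The matrix over `D_2` by which the first component of an operator pair acts, transposed. -/
def innerMatrix : Module.End k (Matrix (Fin 1) J D) × Module.End k (Matrix J (Fin 1) D) →ₗ[k]
    Matrix J J (DTwo D) where
  toFun T := Matrix.of fun i j => DTwo.mk k D (T.1 (Matrix.single 0 i 1) 0 j)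
  map_add' S T := by ext; simp
  map_smul' c T := by ext; simp

theorem innerMatrix_apply
    (T : Module.End k (Matrix (Fin 1) J D) × Module.End k (Matrix J (Fin 1) D)) (i j : J) :
    innerMatrix k J D T i j = DTwo.mk k D (T.1 (Matrix.single 0 i 1) 0 j) := rfl

/-- Since there is one row, xy is a scalar, and over the commutative ring D_2 the map v ↦ xyv + vyx
is right multiplication by (xy)1 + yx. -/
theorem innerMatrix_innerDelta (x : Matrix (Fin 1) J D) (y : Matrix J (Fin 1) D) :
    innerMatrix k J D (innerDelta k x y) =
      (∑ l, DTwo.mk k D (x 0 l) * DTwo.mk k D (y l 0)) • 1 +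
        y.map (DTwo.mk k D) * x.map (DTwo.mk k D) := by
  ext i j
  rw [innerMatrix_apply]
  rcases eq_or_ne i j with rfl | h
  · simp [innerDelta, Matrix.mul_apply, Matrix.single_apply, apply_ite]
  · simp [innerDelta, Matrix.mul_apply, Matrix.single_apply, h]

theorem mk_fst_apply {T : Module.End k (Matrix (Fin 1) J D) × Module.End k (Matrix J (Fin 1) D)}
    (hT : T ∈ innerDer k (Fin 1) J D) (v : Matrix (Fin 1) J D) :
    (T.1 v).map (DTwo.mk k D) = v.map (DTwo.mk k D) * innerMatrix k J D T := by
  induction hT using Submodule.span_induction with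
  | mem T h =>
    obtain ⟨x, y, rfl⟩ := h
    rw [innerMatrix_innerDelta, Matrix.mul_add, Matrix.mul_smul, Matrix.mul_one]
    have h : ∀ m : Matrix (Fin 1) (Fin 1) (DTwo D), ∀ n : Matrix (Fin 1) J (DTwo D),
        m * n = m 0 0 • n := by
      intro m n
      ext i j
      obtain rfl := Subsingleton.elim i 0
      simp [Matrix.mul_apply]
    simp only [innerDelta, jordanTriple_apply, Matrix.map_add _ (map_add (DTwo.mk k D)),
      Matrix.map_mul]
    rw [h, Matrix.mul_assoc]
    simp [Matrix.mul_apply]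
  | zero => ext; simp
  | add S T _ _ hS hT =>
    rw [map_add, Matrix.mul_add, ← hS, ← hT]
    exact Matrix.map_add _ (map_add (DTwo.mk k D)) _ _
  | smul c T _ hT =>
    rw [map_smul, Matrix.mul_smul, ← hT]
    exact Matrix.map_smul _ c (map_smul (DTwo.mk k D) c) _

/-- On V⁻ the action carries a minus sign, invisible in characteristic two; so the same matrix acts,
now from the left. -/
theorem mk_snd_apply {T : Module.End k (Matrix (Fin 1) J D) × Module.End k (Matrix J (Fin 1) D)}
    (hT : T ∈ innerDer k (Fin 1) J D) (w : Matrix J (Fin 1) D) :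
    (T.2 w).map (DTwo.mk k D) = innerMatrix k J D T * w.map (DTwo.mk k D) := by
  induction hT using Submodule.span_induction with
  | mem T h =>
    obtain ⟨x, y, rfl⟩ := h
    rw [innerMatrix_innerDelta, Matrix.add_mul, Matrix.smul_mul, Matrix.one_mul]
    have h : ∀ m : Matrix (Fin 1) (Fin 1) (DTwo D), ∀ n : Matrix J (Fin 1) (DTwo D),
        n * m = m 0 0 • n := by
      intro m n
      ext i j
      obtain rfl := Subsingleton.elim j 0
      simp [Matrix.mul_apply, mul_comm]
    ext i j
    simp only [innerDelta, LinearMap.neg_apply, jordanTriple_apply, Matrix.map_apply,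
      Matrix.neg_apply, map_neg, DTwo.neg_eq]
    rw [← Matrix.map_apply (f := DTwo.mk k D), Matrix.map_add _ (map_add (DTwo.mk k D)),
      Matrix.map_mul, Matrix.map_mul, Matrix.map_mul, Matrix.map_mul, Matrix.mul_assoc (w.map _), h,
      add_comm]
    simp [Matrix.mul_apply]
  | zero => ext; simp
  | add S T _ _ hS hT =>
    rw [map_add, Matrix.add_mul, ← hS, ← hT]
    exact Matrix.map_add _ (map_add (DTwo.mk k D)) _ _
  | smul c T _ hT =>
    rw [map_smul, Matrix.smul_mul, ← hT]
    exact Matrix.map_smul _ c (map_smul (DTwo.mk k D) c) _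

/-- The order is reversed because the matrices act on rows from the right. -/
theorem innerMatrix_mul {S T : Module.End k (Matrix (Fin 1) J D) × Module.End k (Matrix J (Fin 1) D)}
    (hS : S ∈ innerDer k (Fin 1) J D) :
    innerMatrix k J D (S * T) = innerMatrix k J D T * innerMatrix k J D S := by
  ext i j
  have h := congrFun₂ (mk_fst_apply hS (T.1 (Matrix.single 0 i 1))) 0 j
  simpa [Matrix.mul_apply, innerMatrix_apply] using h

/-- The trace of (xy)1 + yx is (|J| + 1)xy, an even multiple of xy. -/
theorem trace_innerMatrix
    {T : Module.End k (Matrix (Fin 1) J D) × Module.End k (Matrix J (Fin 1) D)}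
    (hT : T ∈ innerDer k (Fin 1) J D) (hJ : Odd (Fintype.card J)) :
    (innerMatrix k J D T).trace = 0 := by
  induction hT using Submodule.span_induction with
  | mem T h =>
    obtain ⟨x, y, rfl⟩ := h
    obtain ⟨n, hn⟩ := hJ
    rw [innerMatrix_innerDelta, Matrix.trace_add, Matrix.trace_smul, Matrix.trace_one, hn]
    have h : (y.map (DTwo.mk k D) * x.map (DTwo.mk k D)).trace =
        ∑ l, DTwo.mk k D (x 0 l) * DTwo.mk k D (y l 0) := by
      simp [Matrix.trace, Matrix.mul_apply, mul_comm]
    rw [h]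
    push_cast
    rw [DTwo.two_eq_zero, zero_mul, zero_add, smul_eq_mul, mul_one, ← two_mul, DTwo.two_eq_zero,
      zero_mul]
  | zero => simp
  | add S T _ _ hS hT => rw [map_add, Matrix.trace_add, hS, hT, add_zero]
  | smul c T _ hT => rw [map_smul, Matrix.trace_smul, hT, smul_zero]

variable (k J D) in
/-- A linear map to the matrices over `D_2` that preserves brackets up to diagonal matrices. -/
def matrixMap : TKK k (Fin 1) J D →ₗ[k] Matrix (Fin 1 ⊕ J) (Fin 1 ⊕ J) (DTwo D) where
  toFun X := Matrix.fromBlocks 0 (X.pos.map (DTwo.mk k D)) (X.neg.map (DTwo.mk k D))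
    (innerMatrix k J D X.inn.1)
  map_add' X Y := by
    simp [Matrix.fromBlocks_add, Matrix.map_add _ (map_add (DTwo.mk k D))]
  map_smul' c X := by
    simp [Matrix.fromBlocks_smul, Matrix.map_smul _ c (map_smul (DTwo.mk k D) c)]

theorem matrixMap_apply (X : TKK k (Fin 1) J D) :
    matrixMap k J D X = Matrix.fromBlocks 0 (X.pos.map (DTwo.mk k D)) (X.neg.map (DTwo.mk k D))
      (innerMatrix k J D X.inn.1) := rfl

theorem matrixMap_rootVector {p q : Fin 1 ⊕ J} (hpq : p ≠ q) (a : D) :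
    matrixMap k J D (rootVector p q a) = Matrix.single p q (DTwo.mk k D a) := by
  rcases p with p | p <;> rcases q with q | q
  · exact absurd (congrArg Sum.inl (Subsingleton.elim p q)) hpq
  · ext (i | i) (j | j) <;>
      simp [matrixMap_apply, rootVector, ofPos, Matrix.single_apply]
  · ext (i | i) (j | j) <;>
      simp [matrixMap_apply, rootVector, ofNeg, Matrix.single_apply]
  · have h : p ≠ q := fun h => hpq (congrArg _ h)
    have key : innerMatrix k J D (innerDelta k (Matrix.single 0 q a) (Matrix.single p 0 1)) =
        Matrix.single p q (DTwo.mk k D a) := by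
      rw [innerMatrix_innerDelta]
      simp [Matrix.single_apply, apply_ite, h.symm]
    rw [rootVector, map_neg, matrixMap_apply]
    simp only [ofDelta, key]
    ext (i | i) (j | j) <;> simp [Matrix.single_apply, DTwo.neg_eq]

theorem trace_matrixMap (X : TKK k (Fin 1) J D) (hJ : Odd (Fintype.card J)) :
    (matrixMap k J D X).trace = 0 := by
  rw [matrixMap_apply, ← trace_innerMatrix X.inn.2 hJ]
  simp [Matrix.trace]

/-- For x in V⁺ and y in V⁻ the commutator has diagonal blocks xy and -yx, while [x, y] goes to 0
and (xy)1 + yx. In characteristic two these differ by the scalar matrix xy, hence the restriction p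
≠ q. -/
theorem matrixMap_lie_apply (X Y : TKK k (Fin 1) J D) {p q : Fin 1 ⊕ J} (hpq : p ≠ q) :
    matrixMap k J D ⁅X, Y⁆ p q = (matrixMap k J D X * matrixMap k J D Y -
      matrixMap k J D Y * matrixMap k J D X) p q := by
  have hX := X.inn.2
  have hY := Y.inn.2
  simp only [matrixMap_apply, Matrix.fromBlocks_multiply, pos_lie, neg_lie, coe_inn_lie,
    Matrix.map_sub _ (map_sub (DTwo.mk k D)), mk_fst_apply hX, mk_fst_apply hY, mk_snd_apply hX,
    mk_snd_apply hY, map_add, map_sub, innerMatrix_mul hX, innerMatrix_mul hY,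
    innerMatrix_innerDelta, Matrix.sub_apply]
  rcases p with p | p <;> rcases q with q | q
  · exact absurd (congrArg Sum.inl (Subsingleton.elim p q)) hpq
  · simp
    exact (DTwo.neg_eq _).symm.trans (neg_sub _ _)
  · simp
  · have h : p ≠ q := fun h => hpq (congrArg _ h)
    simp [h]
    refine (DTwo.neg_eq _).symm.trans ?_
    abel

end TKK

end Cocycle

/-! ### The alternating cocycle and the induced map uce(L) → D_2 -/

section CrossPairing

/-- The alternating form on matrices of characteristic two that belongs to the weight
`ε_p - ε_q + ε_r - ε_s`. -/
def crossPairing {ι R : Type*} [CommRing R] (p q r s : ι) (A B : Matrix ι ι R) : R :=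
  A p q * B r s + A r s * B p q + A p s * B r q + A r q * B p s

/-- The form polarizes the minor A_pq A_rs + A_ps A_rq, so its value at (A, A) is twice that minor.
-/
theorem crossPairing_self {ι R : Type*} [CommRing R] (h2 : (2 : R) = 0) (p q r s : ι)
    (A : Matrix ι ι R) : crossPairing p q r s A A = 0 := by
  unfold crossPairing
  linear_combination (A p q * A r s + A p s * A r q) * h2

/-- `crossPairing` is a cocycle on traceless `4 × 4` matrices of characteristic two. -/
theorem crossPairing_cocycle {ι R : Type*} [Fintype ι] [CommRing R] (h2 : (2 : R) = 0)
    {p q r s : ι} (hsum : ∀ f : ι → R, ∑ i, f i = f p + f q + f r + f s) {A B C : Matrix ι ι R}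
    (hA : A.trace = 0) (hB : B.trace = 0) (hC : C.trace = 0) :
    crossPairing p q r s A (B * C - C * B) + crossPairing p q r s B (C * A - A * C) +
      crossPairing p q r s C (A * B - B * A) = 0 := by
  simp only [crossPairing, Matrix.sub_apply, Matrix.mul_apply, Matrix.trace, Matrix.diag,
    hsum] at *
  clear hsum
  -- A polynomial identity in the matrix entries, modulo 2 and the three trace relations.
  grind

/-- No diagonal entry enters the form, so `matrixMap` need only respect brackets off the diagonal.
-/
theorem crossPairing_congr_right {ι R : Type*} [CommRing R] {p q r s : ι} (hpq : p ≠ q)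
    (hps : p ≠ s) (hqr : q ≠ r) (hrs : r ≠ s) (A : Matrix ι ι R) {B C : Matrix ι ι R}
    (h : ∀ i j, i ≠ j → B i j = C i j) :
    crossPairing p q r s A B = crossPairing p q r s A C := by
  simp only [crossPairing, h p q hpq, h r s hrs, h p s hps, h r q hqr.symm]

variable (k : Type*) [CommRing k] (D : Type*) [Ring D] [Algebra k D]

/-- `crossPairing` as a bilinear form on `TKK(M(1, 3, D))` with values in `D_2`. -/
def crossForm (p q r s : IndexA3) : LieA3 k D →ₗ[k] LieA3 k D →ₗ[k] DTwo D :=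
  LinearMap.mk₂ k (fun X Y => crossPairing p q r s (TKK.matrixMap k (Fin 3) D X)
      (TKK.matrixMap k (Fin 3) D Y))
    (fun X X' Y => by simp only [crossPairing, map_add, Matrix.add_apply]; ring)
    (fun c X Y => by
      simp only [crossPairing, map_smul, Matrix.smul_apply, smul_mul_assoc, smul_add])
    (fun X Y Y' => by simp only [crossPairing, map_add, Matrix.add_apply]; ring)
    (fun c X Y => by
      simp only [crossPairing, map_smul, Matrix.smul_apply, mul_smul_comm, smul_add])

theorem crossForm_apply (p q r s : IndexA3) (X Y : LieA3 k D) :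
    crossForm k D p q r s X Y = crossPairing p q r s (TKK.matrixMap k (Fin 3) D X)
      (TKK.matrixMap k (Fin 3) D Y) := rfl

variable {p q r s : IndexA3} (hpq : p ≠ q) (hpr : p ≠ r) (hps : p ≠ s) (hqr : q ≠ r)
  (hqs : q ≠ s) (hrs : r ≠ s)

/-- The linear map `uce(L) → D_2` induced by `crossForm`. -/
def uceToDTwo : UCE k (LieA3 k D) →ₗ[k] DTwo D :=
  (uceRelations k (LieA3 k D)).liftQ (TensorProduct.lift (crossForm k D p q r s)) (by
    have h2 := DTwo.two_eq_zero D
    have hsum : ∀ f : IndexA3 → DTwo D, ∑ i, f i = f p + f q + f r + f s := by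
      intro f
      have h : (Finset.univ : Finset IndexA3) = {p, q, r, s} := by
        ext t
        simpa using IndexA3.eq_or_eq hpq hpr hps hqr hqs hrs t
      rw [h, Finset.sum_insert (by simp [hpq, hpr, hps]), Finset.sum_insert (by simp [hqr, hqs]),
        Finset.sum_insert (by simp [hrs]), Finset.sum_singleton]
      ring
    have htr : ∀ X : LieA3 k D, (TKK.matrixMap k (Fin 3) D X).trace = 0 :=
      fun X => TKK.trace_matrixMap X (by decide)
    have hlie : ∀ X Y Z : LieA3 k D, crossForm k D p q r s X ⁅Y, Z⁆ =
        crossPairing p q r s (TKK.matrixMap k (Fin 3) D X)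
          (TKK.matrixMap k (Fin 3) D Y * TKK.matrixMap k (Fin 3) D Z -
            TKK.matrixMap k (Fin 3) D Z * TKK.matrixMap k (Fin 3) D Y) :=
      fun X Y Z => crossPairing_congr_right hpq hps hqr hrs _
        fun i j hij => TKK.matrixMap_lie_apply Y Z hij
    rw [uceRelations, Submodule.span_le]
    rintro t (⟨X, rfl⟩ | ⟨X, Y, Z, rfl⟩)
    · exact crossPairing_self h2 p q r s _
    · simp only [SetLike.mem_coe, LinearMap.mem_ker, map_add, TensorProduct.lift.tmul, hlie]
      exact crossPairing_cocycle h2 hsum (htr X) (htr Y) (htr Z))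

theorem uceToDTwo_cls (X Y : LieA3 k D) :
    uceToDTwo k D hpq hpr hps hqr hqs hrs (UCE.cls k X Y) = crossForm k D p q r s X Y := rfl

theorem uceToDTwo_cls_rootVector (a b : D) :
    uceToDTwo k D hpq hpr hps hqr hqs hrs
      (UCE.cls k (TKK.rootVector p q a) (TKK.rootVector r s b)) = DTwo.mk k D (a * b) := by
  rw [uceToDTwo_cls, crossForm_apply, TKK.matrixMap_rootVector hpq, TKK.matrixMap_rootVector hrs]
  simp [crossPairing, Matrix.single_apply, hpr.symm, hqs]

end CrossPairing

/-! ### The homogeneous components of uce(L) -/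

section Components

variable (k : Type*) [CommRing k] (D : Type*) [Ring D] [Algebra k D]

/-- The elements `⟨E_pr(a), E_rq(1)⟩` exhaust `uce(L)_α`, `α = ε_p - ε_q`. -/
theorem uceComponent_root_le {p q r : IndexA3} (hpq : p ≠ q) (hpr : p ≠ r) (hqr : q ≠ r) :
    uceComponent k D (eps p - eps q) ≤ LinearMap.range
      (UCE.clsLeft k (TKK.rootMap k (Fin 3) D r q 1) ∘ₗ TKK.rootMap k (Fin 3) D p r) := by
  have hE := TKK.isElementaryFamily_rootMap k (Fin 3) D
  have h4 := IndexA3.exists_ne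
  refine UCE.component_le_of_span k TKK.component_le_span_generators ?_
  rintro δ ε hδε _ (⟨i, j, a, hij, rfl, rfl⟩ | ⟨rfl, i, j, a, a', hij, rfl⟩) _
    (⟨l, m, b, hlm, rfl, rfl⟩ | ⟨rfl, l, m, b, b', hlm, rfl⟩)
  · rcases eps_sub_eps_add_eq_root hij hlm hpq hδε with ⟨rfl, rfl, rfl⟩ | ⟨rfl, rfl, rfl⟩
    · exact ⟨a * b, (hE.cls_chain hpq hij hlm.symm hpr hqr h4 a b).symm⟩
    · rw [UCE.cls_swap]
      exact neg_mem ⟨b * a, (hE.cls_chain hpq hlm hij.symm hpr hqr h4 b a).symm⟩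
  · rw [add_zero] at hδε
    obtain ⟨rfl, rfl⟩ := eps_sub_eps_injective hij hδε
    rw [UCE.cls_swap]
    exact neg_mem (hE.cls_cartan_mem hpq hpr hqr h4
      (fun s t hst c => hE.lie_lie_mem hlm hst h4 b b' c) a)
  · rw [zero_add] at hδε
    obtain ⟨rfl, rfl⟩ := eps_sub_eps_injective hlm hδε
    exact hE.cls_cartan_mem hpq hpr hqr h4 (fun s t hst c => hE.lie_lie_mem hij hst h4 a a' c) b
  · rw [add_zero] at hδε
    exact absurd hδε.symm (eps_sub_eps_ne_zero hpq)

theorem cls_rootVector_mem {p q r s : IndexA3} (hpq : p ≠ q) (hrs : r ≠ s) {γ : IndexA3 → ℤ}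
    (h : (eps p - eps q) + (eps r - eps s) = γ) (a b : D) :
    UCE.cls k (TKK.rootVector p q a) (TKK.rootVector r s b) ∈ uceComponent k D γ :=
  UCE.cls_mem_component k (TKK.rootVector_mem_component hpq a)
    (TKK.rootVector_mem_component hrs b) h

/-- The lift is ⟨E_pr(a), E_rq(1)⟩ for a third index r. These elements exhaust the component, and u
recovers a from them. -/
theorem existsUnique_lift_rootVector {p q : IndexA3} (hpq : p ≠ q) (a : D) :
    ∃! X : UCE k (LieA3 k D), X ∈ uceComponent k D (eps p - eps q) ∧
      UCE.toLie k (LieA3 k D) X = TKK.rootVector p q a := by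
  obtain ⟨r, hrp, hrq, -⟩ := IndexA3.exists_ne p q q
  have hlie : ∀ c, ⁅(TKK.rootVector p r c : LieA3 k D), (TKK.rootVector r q 1 : LieA3 k D)⁆ =
      TKK.rootVector p q c := fun c => by
    rw [TKK.lie_rootVector_mul hrp.symm hrq hpq, mul_one]
  refine ⟨UCE.cls k (TKK.rootVector p r a) (TKK.rootVector r q 1),
    ⟨cls_rootVector_mem k D hrp.symm hrq (by abel) a 1, by rw [UCE.toLie_cls, hlie]⟩, ?_⟩
  rintro X ⟨hX, hXa⟩
  obtain ⟨c, rfl⟩ := uceComponent_root_le k D hpq hrp.symm hrq.symm hX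
  have hc : TKK.rootVector (k := k) p q c = TKK.rootVector p q a := by
    rw [← hXa, ← hlie]; rfl
  rw [TKK.rootVector_injective hpq hc]
  rfl

/-- Composable pairs and pairs involving degree 0 have weight in R. The other pairs vanish unless
all four indices are distinct. -/
theorem isDegenerateSum_of_uceComponent_ne_bot {γ : IndexA3 → ℤ} (hγ : γ ∉ rootSystemA IndexA3)
    (hne : uceComponent k D γ ≠ ⊥) : IsDegenerateSum γ := by
  have hE := TKK.isElementaryFamily_rootMap k (Fin 3) D
  have hroot : ∀ i j : IndexA3, γ ≠ eps i - eps j := by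
    rintro i j rfl
    refine hγ ?_
    rcases eq_or_ne i j with rfl | hij
    · exact Or.inl (sub_self _)
    · exact Or.inr ⟨i, j, hij, rfl⟩
  by_contra hdeg
  refine hne (eq_bot_iff.2 (UCE.component_le_of_span k TKK.component_le_span_generators ?_))
  rintro δ ε rfl _ (⟨i, j, a, hij, rfl, rfl⟩ | ⟨rfl, i, j, a, a', hij, rfl⟩) _
    (⟨l, m, b, hlm, rfl, rfl⟩ | ⟨rfl, l, m, b, b', hlm, rfl⟩)
  · have hjl : j ≠ l := by rintro rfl; exact hroot i m (by abel)
    have him : i ≠ m := by rintro rfl; exact hroot l j (by abel)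
    rcases eq_or_ne i l with rfl | hil
    · rcases eq_or_ne j m with rfl | hjm
      · obtain ⟨t, hti, htj, -⟩ := IndexA3.exists_ne i j j
        exact hE.cls_self_root hij hti htj a b
      · obtain ⟨t, hti, htj, htm⟩ := IndexA3.exists_ne i j m
        exact hE.cls_same_row hij him hti htj htm a b
    · rcases eq_or_ne j m with rfl | hjm
      · obtain ⟨t, hti, htj, htl⟩ := IndexA3.exists_ne i j l
        exact hE.cls_same_column hij hlm hti htj htl a b
      · exact absurd (isDegenerateSum_of_distinct hij hil him hjl hjm hlm
          (IndexA3.eq_or_eq hij hil him hjl hjm hlm)) hdeg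
  · exact absurd (add_zero _) (hroot i j)
  · exact absurd (zero_add _) (hroot l m)
  · exact absurd (by simp) (hroot (.inl 0) (.inl 0))

section Degenerate

variable {k D} {p q r s : IndexA3} (hpq : p ≠ q) (hpr : p ≠ r) (hps : p ≠ s) (hqr : q ≠ r)
  (hqs : q ≠ s) (hrs : r ≠ s)
include hpq hpr hps hqr hqs hrs

/-- All products of root vectors of total weight `ε_p - ε_q + ε_r - ε_s` are of one form. -/
theorem cls_rootVector_degenerate {p' q' r' s' : IndexA3}
    (h : (eps p' - eps q') + (eps r' - eps s') = (eps p - eps q) + (eps r - eps s)) (a b : D) :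
    ∃ c, DTwo.mk k D c = DTwo.mk k D (a * b) ∧
      UCE.cls k (TKK.rootVector (k := k) p' q' a) (TKK.rootVector r' s' b) =
        UCE.cls k (TKK.rootVector p q c) (TKK.rootVector r s 1) := by
  have hE := TKK.isElementaryFamily_rootMap k (Fin 3) D
  -- Interchanging the two arguments replaces ab by -(ba), which has the same class in D_2.
  have hcomm : DTwo.mk k D (-(b * a)) = DTwo.mk k D (a * b) := by
    rw [map_neg, DTwo.neg_eq, map_mul, map_mul, mul_comm]
  have hneg : ∀ c : D, UCE.cls k (TKK.rootVector p q (-c)) (TKK.rootVector r s 1) =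
      -UCE.cls k (TKK.rootVector (k := k) p q c) (TKK.rootVector r s 1) := fun c =>
    map_neg (UCE.clsLeft k (TKK.rootVector r s 1) ∘ₗ TKK.rootMap k (Fin 3) D p q) c
  obtain ⟨⟨rfl, rfl⟩ | ⟨rfl, rfl⟩, ⟨rfl, rfl⟩ | ⟨rfl, rfl⟩⟩ :=
    eps_sub_eps_add_eq_degenerate hpq hpr hps hqr hqs hrs h
  -- The relations above have rows p, q and columns r, s; here the rows are p, r and the columns q,
  -- s, whence the permuted hypotheses.
  · exact ⟨_, rfl, hE.cls_opposite hpr hpq hps hqr.symm hrs hqs a b⟩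
  · exact ⟨_, rfl, hE.cls_opposite_swap hpr hpq hps hqr.symm hrs hqs a b⟩
  · refine ⟨_, hcomm, ?_⟩
    rw [UCE.cls_swap, hneg]
    exact congrArg _ (hE.cls_opposite_swap hpr hpq hps hqr.symm hrs hqs b a)
  · refine ⟨_, hcomm, ?_⟩
    rw [UCE.cls_swap, hneg]
    exact congrArg _ (hE.cls_opposite hpr hpq hps hqr.symm hrs hqs b a)

variable (k D) in
-- The weight is neither a root nor 0, so the degree-zero part of L contributes nothing.
theorem uceComponent_degenerate_le :
    uceComponent k D ((eps p - eps q) + (eps r - eps s)) ≤ LinearMap.range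
      (UCE.clsLeft k (TKK.rootMap k (Fin 3) D r s 1) ∘ₗ TKK.rootMap k (Fin 3) D p q) := by
  have hroot : ∀ i j : IndexA3, i ≠ j → (eps i - eps j) ≠ (eps p - eps q) + (eps r - eps s) := by
    intro i j hij h
    rcases eps_sub_eps_add_eq_root hpq hrs hij h.symm with h | h
    · exact hqr h.1
    · exact hps h.1
  refine UCE.component_le_of_span k TKK.component_le_span_generators ?_
  rintro δ ε hδε _ (⟨i, j, a, hij, rfl, rfl⟩ | ⟨rfl, i, j, a, a', hij, rfl⟩) _
    (⟨l, m, b, hlm, rfl, rfl⟩ | ⟨rfl, l, m, b, b', hlm, rfl⟩)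
  · obtain ⟨c, -, hc⟩ := cls_rootVector_degenerate (k := k) hpq hpr hps hqr hqs hrs hδε a b
    exact ⟨c, hc.symm⟩
  · exact absurd ((add_zero _).symm.trans hδε) (hroot i j hij)
  · exact absurd ((zero_add _).symm.trans hδε) (hroot l m hlm)
  · have h := congrFun hδε p
    simp [eps_apply, hpq, hpr, hps] at h

variable (k D) in
-- The component consists of the ψ(c), and ψ(c) maps to the class of c. If that class is zero, c
-- lies in the ideal, which ψ kills.
theorem bijective_uceToDTwo_domRestrict :
    Function.Bijective ((uceToDTwo k D hpq hpr hps hqr hqs hrs).domRestrict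
      (uceComponent k D ((eps p - eps q) + (eps r - eps s)))) := by
  have hE := TKK.isElementaryFamily_rootMap k (Fin 3) D
  constructor
  · rw [← LinearMap.ker_eq_bot, LinearMap.ker_eq_bot']
    rintro ⟨X, hX⟩ h
    rw [LinearMap.domRestrict_apply] at h
    obtain ⟨c, rfl⟩ := uceComponent_degenerate_le k D hpq hpr hps hqr hqs hrs hX
    have hc : DTwo.mk k D c = 0 := by
      refine Eq.trans ?_ h
      refine Eq.trans ?_ (uceToDTwo_cls_rootVector k D hpq hpr hps hqr hqs hrs c 1).symm
      rw [mul_one]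
    exact Subtype.ext
      (hE.cls_opposite_eq_zero hpr hpq hps hqr.symm hrs hqs (DTwo.mk_eq_zero.1 hc))
  · intro y
    obtain ⟨c, rfl⟩ := DTwo.mk_surjective (k := k) y
    refine ⟨⟨_, cls_rootVector_mem k D hpq hrs rfl c 1⟩, ?_⟩
    rw [LinearMap.domRestrict_apply, uceToDTwo_cls_rootVector, mul_one]

end Degenerate

end Components

theorem mainTheorem4 (k : Type*) [CommRing k] (D : Type*) [Ring D] [Algebra k D] :
    -- for each root `α = ε_p - ε_q`, the elements `x_α(a) = u⁻¹(E_{pq}(a))` are well defined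
    (∀ p q : IndexA3, p ≠ q → ∀ a : D, ∃! X : UCE k (LieA3 k D),
      X ∈ uceComponent k D (eps p - eps q) ∧
        UCE.toLie k (LieA3 k D) X = TKK.rootVector p q a) ∧
    -- there are exactly six degenerate sums
    ({γ : IndexA3 → ℤ | IsDegenerateSum γ} = sixSums ∧ sixSums.ncard = 6) ∧
    -- each degree of `uce(L)` outside the root system is a degenerate sum
    (∀ γ : IndexA3 → ℤ, γ ∉ rootSystemA IndexA3 → uceComponent k D γ ≠ ⊥ →
      IsDegenerateSum γ) ∧
    -- `uce(L)_γ ≅ D_2` by `[x_α(a), x_β(b)] ↦ class of a b`, for each degenerate sum `γ = α + β`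
    (∀ γ : IndexA3 → ℤ, IsDegenerateSum γ →
      ∃ φ : uceComponent k D γ ≃ₗ[k] DTwo D,
        ∀ p q r s : IndexA3, p ≠ q → r ≠ s → (eps p - eps q) + (eps r - eps s) = γ →
          ∀ (a b : D) (X Y : UCE k (LieA3 k D)),
            X ∈ uceComponent k D (eps p - eps q) →
            UCE.toLie k (LieA3 k D) X = TKK.rootVector p q a →
            Y ∈ uceComponent k D (eps r - eps s) →
            UCE.toLie k (LieA3 k D) Y = TKK.rootVector r s b →
            ∃ h : ⁅X, Y⁆ ∈ uceComponent k D γ, φ ⟨⁅X, Y⁆, h⟩ = DTwo.mk k D (a * b)) := by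
  refine ⟨fun p q hpq a => existsUnique_lift_rootVector k D hpq a,
    ⟨Set.ext isDegenerateSum_iff_mem_sixSums, ncard_sixSums⟩,
    fun γ hγ hne => isDegenerateSum_of_uceComponent_ne_bot k D hγ hne, fun γ hγ => ?_⟩
  obtain ⟨p, q, r, s, hpq, hpr, hps, hqr, hqs, hrs, rfl⟩ := hγ.exists_distinct IndexA3.exists_ne
  refine ⟨LinearEquiv.ofBijective _
    (bijective_uceToDTwo_domRestrict k D hpq hpr hps hqr hqs hrs), ?_⟩
  intro p' q' r' s' hpq' hrs' h a b X Y _ hX _ hY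
  obtain ⟨c, hc, hcls⟩ := cls_rootVector_degenerate (k := k) hpq hpr hps hqr hqs hrs h a b
  -- The bracket of uce(L) depends only on the images under u.
  have hXY : ⁅X, Y⁆ = UCE.cls k (TKK.rootVector p q c) (TKK.rootVector r s 1) := by
    rw [UCE.lie_def, hX, hY, hcls]
  have hmem : ⁅X, Y⁆ ∈ uceComponent k D ((eps p - eps q) + (eps r - eps s)) := by
    rw [hXY]
    exact cls_rootVector_mem k D hpq hrs rfl c 1
  refine ⟨hmem, ?_⟩
  rw [LinearEquiv.ofBijective_apply, LinearMap.domRestrict_apply]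
  simp only [hXY]
  rw [uceToDTwo_cls_rootVector, mul_one, hc]
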